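/- Let $E=\{e_1<e_2<\dots<e_n\}$, $n\ge 1$, and let $P^+=\{p_1,p_2,p_3,\dots\}$ be an infinite set of places. Let $\bigwedge E$ be the exterior algebra over $\mathbb{Z}$ of the free module on $E$, and let $\mathrm{Super}(L^-|P^+)$ be the exterior algebra over $\mathbb{Z}$ of the free module on the set of symbols $(e|p)$, $e\in E$, $p\in P^+$. For a finitely supported sequence $\alpha=(\alpha_1,\alpha_2,\dots)$ of non-negative integers write $p^{(\alpha)}=p_1^{(\alpha_1)}p_2^{(\alpha_2)}\cdots$ for the corresponding monomial in the divided power algebra on $P^+$. The Laplace pairing $(w|p^{(\alpha)})\in\mathrm{Super}(L^-|P^+)$, linear in $w\in\bigwedge E$, is determined by: $(1|1)=1$; $(e|p_j^{(1)})$ is the generator $(e|p_j)$; $(w|p^{(\alpha)})=0$ if $w$ is homogeneous of degree different from $|\alpha|=\sum_j\alpha_j$; and $(ww'|p^{(\alpha)})=\sum_{\beta+\gamma=\alpha}(w|p^{(\beta)})(w'|p^{(\gamma)})$. For a matroid $M$ on $E$, the Whitney module $W(M)$ is the quotient of $\mathrm{Super}(L^-|P^+)$ by the two-sided ideal generated by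 all $(w|p^{(\alpha)})$, where $w=e_{i_1}\cdots e_{i_k}$ is a word such that $\{e_{i_1},\dots,e_{i_k}\}$ is dependent in $M$, and $|\alpha|=k$ (zero parts of $\alpha$ are allowed). A row strict tableau has strictly increasing rows and weakly increasing columns; a column strict tableau has weakly increasing rows and strictly increasing columns. For a row strict tableau $T_r$ with entries in $\{1,\dots,n\}$ and a column strict tableau $T_c$ with entries in $\{1,2,3,\dots\}$, of the same shape with $\ell$ rows, put $$\mathrm{tab}(T_r|T_c)=(w_1|q_1)(w_2|q_2)\cdots(w_\ell|q_\ell),$$ where $w_i=e_{t_1}e_{t_2}\cdots$ for the $i$-th row $t_1<t_2<\cdots$ of $T_r$, and $q_i=p^{(\alpha)}$ with $\alpha_k$ the number of entries $k$ in the $i$-th row of $T_c$. For a binary sequence $s=(s_1,\dots,s_n)$ define a matroid $M_s$ on $\{e_1,\dots,e_n\}$ recursively. If $n=1$, $M_s$ is the matroid of rank $s_1$ on $\{e_1\}$. If $n>1$ and $s'=(s_1,\dots,s_{n-1})$, then $M_s=M_{s'}\oplus e_n$ (the direct sum with the rank one matroid on $\{e_n\}$) when $s_n=1$, and $M_s$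 is the truncation of $M_{s'}\oplus e_n$ to the rank of $M_{s'}$ when $s_n=0$, that is, the matroid whose bases are the independent sets of $M_{s'}\oplus e_n$ of size $r(M_{s'})$. The matroids $M_s$ are called freedom matroids (also Schubert or shifted matroids). **Theorem.** Let $M$ be a freedom matroid on $\{e_1<\dots<e_n\}$. Then $W(M)$ is a free $\mathbb{Z}$-module. The images in $W(M)$ of the elements $\mathrm{tab}(T_r|T_c)$, indexed by the pairs $(T_r,T_c)$ of tableaux of the same shape such that $T_r$ is row strict with entries in $\{1,\dots,n\}$, $T_c$ is column strict with entries in $\{1,2,3,\dots\}$, and every row of $T_r$ indexes an independent set of $M$, form a $\mathbb{Z}$-basis of $W(M)$. -/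

import Mathlib

/-! ## The letter-place algebra and the Laplace pairing -/

/-- The exterior algebra `Super(L⁻)` of the free `ℤ`-module on a set `E` of (negative) letters. -/
abbrev LetterAlgebra (E : Type*) : Type _ := ExteriorAlgebra ℤ (E →₀ ℤ)

/-- The letter-place algebra `Super(L⁻|P⁺)`: the exterior algebra of the free `ℤ`-module on the
letter-place pairs `(e|p_j)`. The places `p_0, p_1, p_2, …` are indexed by `ℕ`. -/
abbrev LetterPlaceAlgebra (E : Type*) : Type _ := ExteriorAlgebra ℤ (E × ℕ →₀ ℤ)

namespace LetterPlaceAlgebra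

noncomputable section

variable {E : Type*}

/-- The letter `e` as an element of the exterior algebra on the letters. -/
def letter (e : E) : LetterAlgebra E :=
  ExteriorAlgebra.ι ℤ (Finsupp.single e 1)

/-- The letter-place pair `(e|p_j)`. -/
def pair (e : E) (j : ℕ) : LetterPlaceAlgebra E :=
  ExteriorAlgebra.ι ℤ (Finsupp.single (e, j) 1)

/-- The decomposable element `e_1 e_2 ⋯ e_k` given by a word in the letters. -/
def word (w : List E) : LetterAlgebra E := (w.map letter).prod

/-- For `β` of degree one, `β = single j 1`, this is the linear map `e ↦ (e, j)`;
it is zero for all other `β`. -/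
def slot (β : ℕ →₀ ℕ) : (E →₀ ℤ) →ₗ[ℤ] (E × ℕ →₀ ℤ) :=
  if β.degree = 1 then ∑ j ∈ β.support, Finsupp.lmapDomain ℤ ℤ (fun e => (e, j)) else 0

/-- The linear map `e ↦ ∑_j (e|p_j) t_j` to power series in variables `t_0, t_1, …`
over the letter-place algebra. -/
def genLetter : (E →₀ ℤ) →ₗ[ℤ] MvPowerSeries ℕ (LetterPlaceAlgebra E) where
  toFun v := fun β => ExteriorAlgebra.ι ℤ (slot β v)
  map_add' v w := by funext β; simp only [map_add]; rfl
  map_smul' c v := by funext β; simp only [map_smul]; rfl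

theorem genLetter_mul_self (v : E →₀ ℤ) : genLetter v * genLetter v = 0 := by
  classical
  ext α
  rw [MvPowerSeries.coeff_mul, map_zero]
  refine Finset.sum_involution (fun x _ => x.swap) ?_ ?_ ?_ ?_
  · intro x _
    exact ExteriorAlgebra.ι_add_mul_swap (R := ℤ) (slot x.1 v) (slot x.2 v)
  · rintro ⟨β, γ⟩ _ h1 h2
    obtain rfl : γ = β := congrArg Prod.fst h2
    exact h1 (ExteriorAlgebra.ι_sq_zero (R := ℤ) (slot γ v))
  · intro x hx
    exact Finset.HasAntidiagonal.swap_mem_antidiagonal.mpr hx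
  · intro x _
    exact Prod.swap_swap x

/-- The generating function `w ↦ ∑_α (w|p^{(α)}) t^α` of the Laplace pairing, as the algebra
homomorphism that extends `e ↦ ∑_j (e|p_j) t_j`. -/
def laplaceSeries : LetterAlgebra E →ₐ[ℤ] MvPowerSeries ℕ (LetterPlaceAlgebra E) :=
  ExteriorAlgebra.lift ℤ ⟨genLetter, genLetter_mul_self⟩

/-- The Laplace pairing `w ↦ (w|p^{(α)})` with the divided monomial
`p^{(α)} = p_0^{(α_0)} p_1^{(α_1)} ⋯`. The divided monomials form a `ℤ`-basis of the divided power
algebra `Super(P⁺)`, with coproduct `p^{(α)} ↦ ∑_{β + γ = α} p^{(β)} ⊗ p^{(γ)}`. The four lemmas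
below are the rules by which the pairing is defined; they determine it. -/
def laplace (w : LetterAlgebra E) (α : ℕ →₀ ℕ) : LetterPlaceAlgebra E :=
  MvPowerSeries.coeff α (laplaceSeries w)

theorem laplace_one_zero : laplace (1 : LetterAlgebra E) 0 = 1 := by
  simp [laplace]

theorem laplace_letter_single (e : E) (j : ℕ) :
    laplace (letter e) (Finsupp.single j 1) = pair e j := by
  have h : laplaceSeries (letter e) = genLetter (Finsupp.single e 1) :=
    ExteriorAlgebra.lift_ι_apply ℤ _ _ _
  unfold laplace
  rw [h]
  change ExteriorAlgebra.ι ℤ (slot _ _) = _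
  simp [slot, pair]

theorem laplace_mul (w w' : LetterAlgebra E) (α : ℕ →₀ ℕ) :
    laplace (w * w') α = ∑ x ∈ Finset.HasAntidiagonal.antidiagonal α, laplace w x.1 * laplace w' x.2 := by
  classical
  simp [laplace, MvPowerSeries.coeff_mul]

theorem laplace_word_of_degree_ne (w : List E) (α : ℕ →₀ ℕ) (h : α.degree ≠ w.length) :
    laplace (word w) α = 0 := by
  classical
  induction w generalizing α with
  | nil =>
    have h0 : α ≠ 0 := by rintro rfl; simp at h
    simp [laplace, word, MvPowerSeries.coeff_one, h0]
  | cons e w ih =>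
    have hw : word (e :: w) = letter e * word w := by simp [word]
    rw [hw, laplace_mul]
    refine Finset.sum_eq_zero ?_
    rintro ⟨β, γ⟩ hx
    obtain rfl : β + γ = α := Finset.HasAntidiagonal.mem_antidiagonal.mp hx
    by_cases hβ : β.degree = 1
    · have hγ : γ.degree ≠ w.length := by
        intro hc
        apply h
        rw [map_add, hβ, hc, List.length_cons, add_comm]
      simp only [ih γ hγ, mul_zero]
    · have h1 : laplaceSeries (letter e) = genLetter (Finsupp.single e 1) :=
        ExteriorAlgebra.lift_ι_apply ℤ _ _ _
      have h2 : laplace (letter e) β = 0 := by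
        unfold laplace
        rw [h1]
        change ExteriorAlgebra.ι ℤ (slot β _) = _
        simp [slot, hβ]
      simp only [h2, zero_mul]

end

end LetterPlaceAlgebra

/-! ## The Whitney module of a matroid -/

/-- The two-sided ideal generated by the elements `(w|p^{(α)})`, where `w` is a dependent word
of `M` and `α` is a composition of `|w|` (parts equal to zero are allowed).
The ground set of `M` is meant to be all of `E`. -/
noncomputable def whitneyIdeal {E : Type*} (M : Matroid E) : TwoSidedIdeal (LetterPlaceAlgebra E) :=
  TwoSidedIdeal.span
    {x | ∃ (w : List E) (α : ℕ →₀ ℕ), M.Dep {e | e ∈ w} ∧ α.degree = w.length ∧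
      x = LetterPlaceAlgebra.laplace (LetterPlaceAlgebra.word w) α}

/-- The Whitney module `W(M)`. -/
def WhitneyModule {E : Type*} (M : Matroid E) : Type _ := (whitneyIdeal M).ringCon.Quotient

noncomputable instance {E : Type*} (M : Matroid E) : Ring (WhitneyModule M) :=
  inferInstanceAs (Ring (whitneyIdeal M).ringCon.Quotient)

/-- The quotient map `Super(L⁻|P⁺) → W(M)`. -/
noncomputable def WhitneyModule.mk {E : Type*} (M : Matroid E) :
    LetterPlaceAlgebra E →+* WhitneyModule M :=
  (whitneyIdeal M).ringCon.mk'

/-! ## Tableaux -/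

/-- A row strict tableau of shape `μ` with entries in `A`: entries increase strictly along rows
(left to right) and weakly down columns. The cell `(i, j)` is in row `i` and column `j`. Column
strict tableaux, with entries in `ℕ`, are Mathlib's `SemistandardYoungTableau`. -/
structure RowStrictTableau (μ : YoungDiagram) (A : Type*) [Preorder A] where
  entry : {c : ℕ × ℕ // c ∈ μ} → A
  row_strict : ∀ (i j j' : ℕ) (h : (i, j) ∈ μ) (h' : (i, j') ∈ μ), j < j' →
    entry ⟨(i, j), h⟩ < entry ⟨(i, j'), h'⟩
  col_weak : ∀ (i i' j : ℕ) (h : (i, j) ∈ μ) (h' : (i', j) ∈ μ), i < i' →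
    entry ⟨(i, j), h⟩ ≤ entry ⟨(i', j), h'⟩

/-- The entries of the `i`-th row, from left to right. -/
def RowStrictTableau.rowWord {μ : YoungDiagram} {A : Type*} [Preorder A]
    (T : RowStrictTableau μ A) (i : ℕ) : List A :=
  List.ofFn fun j : Fin (μ.rowLen i) => T.entry ⟨(i, j), μ.mem_iff_lt_rowLen.mpr j.isLt⟩

/-- The exponent `α` of the divided monomial `p^{(α)}` of the `i`-th row of a column strict
tableau: `α_k` is the number of entries equal to `k` in that row (they are consecutive). -/
noncomputable def SemistandardYoungTableau.rowContent {μ : YoungDiagram}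
    (S : SemistandardYoungTableau μ) (i : ℕ) : ℕ →₀ ℕ :=
  ∑ j ∈ Finset.range (μ.rowLen i), Finsupp.single (S i j) 1

/-- `tab(T|S) = (w_1|q_1)(w_2|q_2) ⋯ (w_ℓ|q_ℓ)`, the product over the rows from top to bottom. -/
noncomputable def tab {E : Type*} [Preorder E] {μ : YoungDiagram} (T : RowStrictTableau μ E)
    (S : SemistandardYoungTableau μ) : LetterPlaceAlgebra E :=
  (List.ofFn fun i : Fin (μ.colLen 0) =>
    LetterPlaceAlgebra.laplace (LetterPlaceAlgebra.word (T.rowWord i)) (S.rowContent i)).prod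

/-- The standard pairs `(T_r, T_c)`, of a common shape, such that every row of `T_r` indexes an
independent set of `M`. -/
structure IndepStandardTableau {E : Type*} [Preorder E] (M : Matroid E) where
  shape : YoungDiagram
  rowTab : RowStrictTableau shape E
  colTab : SemistandardYoungTableau shape
  indep : ∀ i : ℕ, M.Indep {e | e ∈ rowTab.rowWord i}

/-! ## Freedom matroids -/

/-- The truncation of a matroid on a finite set to rank `k ≤ r(M)`: its independent sets are the
independent sets of `M` with at most `k` elements. -/
def Matroid.truncateTo {α : Type*} [Finite α] (M : Matroid α) (k : ℕ) : Matroid α :=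
  (IndepMatroid.ofFinite (E := M.E) (Set.toFinite _)
    (Indep := fun I => M.Indep I ∧ I.ncard ≤ k)
    (indep_empty := ⟨M.empty_indep, by simp⟩)
    (indep_subset := fun _ _ hJ hIJ =>
      ⟨hJ.1.subset hIJ, (Set.ncard_le_ncard hIJ (Set.toFinite _)).trans hJ.2⟩)
    (indep_aug := by
      intro I J hI hJ hlt
      have hlt' : I.encard < J.encard := by
        rw [← (Set.toFinite I).cast_ncard_eq, ← (Set.toFinite J).cast_ncard_eq]
        exact_mod_cast hlt
      obtain ⟨e, he, hi⟩ := hI.1.augment hJ.1 hlt'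
      refine ⟨e, he.1, he.2, hi, ?_⟩
      rw [Set.ncard_insert_of_notMem he.2 (Set.toFinite _)]
      omega)
    (subset_ground := fun _ hI => hI.1.subset_ground)).matroid

/-- The bases of the truncation to rank `k ≤ r(M)` are the independent sets of size `k`. -/
theorem Matroid.truncateTo_isBase_iff {α : Type*} [Finite α] (M : Matroid α) (k : ℕ)
    (hk : (k : ℕ∞) ≤ M.eRank) (B : Set α) :
    (M.truncateTo k).IsBase B ↔ M.Indep B ∧ B.ncard = k := by
  have hind : ∀ I, (M.truncateTo k).Indep I ↔ M.Indep I ∧ I.ncard ≤ k := by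
    intro I; simp [Matroid.truncateTo]
  have hex : ∃ J, M.Indep J ∧ J.ncard = k := by
    obtain ⟨B', hB'⟩ := M.exists_isBase
    rw [← hB'.encard_eq_eRank] at hk
    obtain ⟨J, hJ, hJk⟩ := Set.exists_subset_encard_eq hk
    exact ⟨J, hB'.indep.subset hJ, by simp [Set.ncard, hJk]⟩
  constructor
  · intro hB
    have h1 := (hind B).mp hB.indep
    refine ⟨h1.1, le_antisymm h1.2 ?_⟩
    obtain ⟨J, hJ, hJk⟩ := hex
    have h2 : (M.truncateTo k).Indep J := (hind J).mpr ⟨hJ, hJk.le⟩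
    have h3 : J.encard ≤ B.encard := by
      rw [hB.encard_eq_eRank]; exact h2.encard_le_eRank
    rw [← (Set.toFinite J).cast_ncard_eq, ← (Set.toFinite B).cast_ncard_eq] at h3
    rw [← hJk]
    exact_mod_cast h3
  · rintro ⟨hB, hBk⟩
    rw [Matroid.isBase_iff_maximal_indep, maximal_iff]
    refine ⟨(hind B).mpr ⟨hB, hBk.le⟩, fun J hJ hBJ => ?_⟩
    exact Set.eq_of_subset_of_ncard_le hBJ (((hind J).mp hJ).2.trans hBk.ge) (Set.toFinite _)

/-- The truncation `T(M)` of `M` to rank `r(M) - 1` (for matroids of positive rank). -/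
noncomputable def Matroid.truncation {α : Type*} [Finite α] (M : Matroid α) : Matroid α :=
  M.truncateTo (M.eRank.toNat - 1)

/-- `M ⊕ e`: the direct sum of `M` with the rank one matroid on a single new element `e`, which
becomes the last element. -/
def Matroid.addColoop {n : ℕ} (M : Matroid (Fin n)) : Matroid (Fin (n + 1)) :=
  (M.sum (Matroid.freeOn (Set.univ : Set (Fin 1)))).mapEquiv finSumFinEquiv

/-- `M + e = T(M ⊕ e)`: the principal extension of `M` along the improper flat. -/
noncomputable def Matroid.addGeneric {n : ℕ} (M : Matroid (Fin n)) : Matroid (Fin (n + 1)) :=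
  M.addColoop.truncation

/-- The matroid `M_s` of a binary sequence `s` of length `n + 1` (`true` is `1`, `false` is `0`). -/
noncomputable def freedomMatroid : (n : ℕ) → (Fin (n + 1) → Bool) → Matroid (Fin (n + 1))
  | 0, s => if s 0 then Matroid.freeOn Set.univ else Matroid.loopyOn Set.univ
  | n + 1, s =>
    if s (Fin.last (n + 1)) then (freedomMatroid n (Fin.init s)).addColoop
    else (freedomMatroid n (Fin.init s)).addGeneric

/-- A freedom matroid on the ordered ground set `{0 < 1 < ⋯ < n}`. -/
def IsFreedomMatroid {n : ℕ} (M : Matroid (Fin (n + 1))) : Prop :=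
  ∃ s : Fin (n + 1) → Bool, M = freedomMatroid n s

/-! Spanning and independence are separate arguments. Spanning holds for every matroid whose ground
set is all of `Fin n`; only independence uses the freedom structure.

Spanning is a straightening law over the integers. Suppose two consecutive rows violate the standard
condition, in the letters or in the places, at a threshold `m`. Pool the entries at least `m` of the
upper row with the small entries of the lower row. The pool is larger than the upper row, and an
exchange identity (`bracket_mul_bracket_mem_of_letters`, `bracket_mul_bracket_mem_of_places`)
rewrites the product by terms with a longer row and by terms of the same row lengths in which the
upper row has a smaller entry sum. The product itself occurs with coefficient 1 or -1, so nothing is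
divided out. Both kinds of terms are later in a well-founded order, which gives `rowsProd_mem`. In
the Whitney module a standard product with a dependent row vanishes, since that row is a generator
of the ideal.

Independence comes from a generic representation. A set `I` is independent in the freedom matroid of
`s` exactly when `I` has at most `h i` elements in `{0, …, i}` for all `i`, where `h i` counts the
ones among `s 0, …, s i` (`freedomMatroid_indep_iff`). Send the letter `e` to a generic vector
supported on the first `h e` coordinates, that is, `(e|p_k)` to the sum of `X (e, c) (c|p_k)` over
`c < h e`. A dependent word has more than `h i` letters at most `i` for some `i`, all landing in a
space of dimension `h i`, so its brackets die and the map factors through the Whitney module.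

For a suitable additive weight, a row with letters `w_0 < w_1 < ⋯` and places `k_0 ≤ k_1 ≤ ⋯` has
the unique lowest term given by the product of the `X (w_j, j) (j|p_{k_j})`; it is present because
independence of the row forces `j < h w_j`. Hence a pair of tableaux has lowest term the product of
all `X (T i j, j) (j|p_{S i j})`, with coefficient 1. This term records the contents of every column
of both tableaux. Columns are monotone, so it determines the pair (`eq_of_cellList_perm`), and
distinct lowest terms with unit coefficients give independence over the integers. -/

namespace LetterPlaceAlgebra

/-! ### Brackets, their sign rules, and Laplace expansion along products of divided monomials -/

noncomputable section

variable {E : Type*}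

/-- The Laplace pairing `(w|p^{(α)})` of a word in the letters with a divided monomial. -/
def bracket (w : List E) (α : ℕ →₀ ℕ) : LetterPlaceAlgebra E := laplace (word w) α

theorem word_cons (e : E) (w : List E) : word (e :: w) = letter e * word w := by simp [word]

theorem word_append (w w' : List E) : word (w ++ w') = word w * word w' := by simp [word]

theorem laplaceSeries_letter (e : E) :
    laplaceSeries (letter e) = genLetter (Finsupp.single e 1) :=
  ExteriorAlgebra.lift_ι_apply ℤ _ _ _

theorem laplace_letter_of_degree_ne_one (e : E) {β : ℕ →₀ ℕ} (hβ : β.degree ≠ 1) :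
    laplace (letter e) β = 0 := by
  unfold laplace
  rw [laplaceSeries_letter]
  change ExteriorAlgebra.ι ℤ (slot β _) = _
  simp [slot, hβ]

theorem bracket_of_degree_ne {w : List E} {α : ℕ →₀ ℕ} (h : α.degree ≠ w.length) :
    bracket w α = 0 := laplace_word_of_degree_ne w α h

theorem bracket_nil (α : ℕ →₀ ℕ) : bracket ([] : List E) α = if α = 0 then 1 else 0 := by
  classical
  simp [bracket, laplace, word, MvPowerSeries.coeff_one]

theorem bracket_append (w w' : List E) (α : ℕ →₀ ℕ) :
    bracket (w ++ w') α =
      ∑ x ∈ Finset.HasAntidiagonal.antidiagonal α, bracket w x.1 * bracket w' x.2 := by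
  simp only [bracket, word_append, laplace_mul]

theorem exists_single_of_degree_eq_one {β : ℕ →₀ ℕ} (h : β.degree = 1) :
    ∃ j, β = Finsupp.single j 1 := by
  classical
  have hne : β.support.Nonempty := by
    rw [Finset.nonempty_iff_ne_empty, Ne, Finsupp.support_eq_empty]
    rintro rfl
    simp at h
  obtain ⟨j, hj⟩ := hne
  refine ⟨j, ?_⟩
  have h1 : Finsupp.single j 1 ≤ β := by
    rw [Finsupp.single_le_iff]
    exact Nat.one_le_iff_ne_zero.mpr (Finsupp.mem_support_iff.mp hj)
  obtain ⟨γ, rfl⟩ := exists_add_of_le h1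
  have h2 : γ.degree = 0 := by
    rw [map_add, Finsupp.degree_single] at h
    omega
  rw [(Finsupp.degree_eq_zero_iff γ).mp h2, add_zero]

theorem bracket_cons (e : E) (w : List E) (α : ℕ →₀ ℕ) :
    bracket (e :: w) α =
      ∑ j ∈ α.support, pair e j * bracket w (α - Finsupp.single j 1) := by
  classical
  have h1 : ∀ j ∈ α.support, Finsupp.single j 1 ≤ α := by
    intro j hj
    rw [Finsupp.single_le_iff]
    exact Nat.one_le_iff_ne_zero.mpr (Finsupp.mem_support_iff.mp hj)
  unfold bracket
  rw [word_cons, laplace_mul]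
  symm
  refine Finset.sum_of_injOn (fun j => (Finsupp.single j 1, α - Finsupp.single j 1)) ?_ ?_ ?_ ?_
  · intro i _ j _ hij
    exact Finsupp.single_left_injective one_ne_zero (congrArg Prod.fst hij)
  · intro j hj
    simp only [Finset.mem_coe, Finset.HasAntidiagonal.mem_antidiagonal]
    exact add_tsub_cancel_of_le (h1 j hj)
  · rintro ⟨β, γ⟩ hx hnot
    have hx' : β + γ = α := Finset.HasAntidiagonal.mem_antidiagonal.mp hx
    -- A letter pairs to zero with anything but a single place, so only the splittings indexed by
    -- places of `α` survive.
    by_cases hβ : β.degree = 1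
    · exfalso
      obtain ⟨j, rfl⟩ := exists_single_of_degree_eq_one hβ
      apply hnot
      refine ⟨j, ?_, ?_⟩
      · subst hx'
        simp
      · subst hx'
        simp
    · simp only [laplace_letter_of_degree_ne_one e hβ, zero_mul]
  · intro j _
    simp only [laplace_letter_single]

theorem letter_mul_letter (e f : E) : letter e * letter f = -(letter f * letter e) :=
  eq_neg_of_add_eq_zero_left (ExteriorAlgebra.ι_add_mul_swap _ _)

theorem letter_mul_self (e : E) : letter e * letter e = 0 := ExteriorAlgebra.ι_sq_zero _

theorem pair_mul_pair (e f : E) (i j : ℕ) : pair e i * pair f j = -(pair f j * pair e i) :=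
  eq_neg_of_add_eq_zero_left (ExteriorAlgebra.ι_add_mul_swap _ _)

theorem word_perm {w w' : List E} (h : w.Perm w') : word w = word w' ∨ word w = -word w' := by
  induction h with
  | nil => exact Or.inl rfl
  | cons e _ ih =>
    rw [word_cons, word_cons]
    rcases ih with ih | ih <;> simp [ih]
  | swap e f l =>
    right
    rw [word_cons, word_cons, word_cons, word_cons, ← mul_assoc, ← mul_assoc, letter_mul_letter,
      neg_mul]
  | trans _ _ ih ih' => rcases ih with ih | ih <;> rcases ih' with ih' | ih' <;> simp [ih, ih']

theorem word_of_not_nodup {w : List E} (h : ¬w.Nodup) : word w = 0 := by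
  induction w with
  | nil => simp at h
  | cons e w ih =>
    rw [List.nodup_cons, not_and_or, not_not] at h
    rcases h with h | h
    · obtain ⟨s, t, rfl⟩ := List.append_of_mem h
      have hp : (s ++ e :: t).Perm (e :: (s ++ t)) := List.perm_middle
      rcases word_perm hp with h' | h' <;>
        simp [word_cons, h', ← mul_assoc, letter_mul_self]
    · rw [word_cons, ih h, mul_zero]

theorem bracket_perm {w w' : List E} (h : w.Perm w') (α : ℕ →₀ ℕ) :
    bracket w α = bracket w' α ∨ bracket w α = -bracket w' α := by
  rcases word_perm h with h | h <;> simp [bracket, laplace, h]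

theorem bracket_of_not_nodup {w : List E} (h : ¬w.Nodup) (α : ℕ →₀ ℕ) : bracket w α = 0 := by
  simp [bracket, laplace, word_of_not_nodup h]

theorem pair_mul_bracket (e : E) (j : ℕ) (w : List E) (α : ℕ →₀ ℕ) :
    pair e j * bracket w α = (-1 : ℤ) ^ w.length • (bracket w α * pair e j) := by
  induction w generalizing α with
  | nil =>
    rw [bracket_nil]
    split_ifs <;> simp
  | cons f w ih =>
    rw [bracket_cons, Finset.mul_sum, Finset.sum_mul, Finset.smul_sum]
    refine Finset.sum_congr rfl fun i _ => ?_
    rw [← mul_assoc, pair_mul_pair, neg_mul, mul_assoc, ih, mul_smul_comm, List.length_cons,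
      pow_succ, mul_assoc]
    simp

theorem bracket_mul_bracket (w w' : List E) (α β : ℕ →₀ ℕ) :
    bracket w α * bracket w' β =
      (-1 : ℤ) ^ (w.length * w'.length) • (bracket w' β * bracket w α) := by
  induction w generalizing α with
  | nil =>
    rw [bracket_nil]
    split_ifs <;> simp
  | cons e w ih =>
    rw [bracket_cons, Finset.mul_sum, Finset.sum_mul, Finset.smul_sum]
    refine Finset.sum_congr rfl fun i _ => ?_
    rw [mul_assoc, ih, mul_smul_comm, ← mul_assoc, pair_mul_bracket, smul_mul_assoc, smul_smul,
      List.length_cons, Nat.add_mul, pow_add, one_mul, mul_assoc]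

/-- The structure constants of the divided power algebra:
`p^{(β)} p^{(γ)} = binom β γ p^{(β + γ)}`. -/
def binom (β γ : ℕ →₀ ℕ) : ℕ := ∏ i ∈ β.support, (β i + γ i).choose (β i)

theorem binom_eq_prod {β γ : ℕ →₀ ℕ} {s : Finset ℕ} (h : β.support ⊆ s) :
    binom β γ = ∏ i ∈ s, (β i + γ i).choose (β i) := by
  refine Finset.prod_subset h fun i _ hi => ?_
  simp [Finsupp.notMem_support_iff.mp hi]

theorem binom_of_disjoint {β γ : ℕ →₀ ℕ} (h : ∀ i, β i = 0 ∨ γ i = 0) : binom β γ = 1 := by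
  refine Finset.prod_eq_one fun i _ => ?_
  rcases h i with h | h <;> simp [h]

theorem binom_zero_zero : binom 0 0 = 1 := by simp [binom]

/-- Pascal's rule in the factor indexed by `j`, the other factors being unchanged. The support
conditions guard against truncated subtraction, which would leave `β` or `γ` unchanged instead of
giving zero. -/
theorem binom_pascal (β γ : ℕ →₀ ℕ) (j : ℕ) (hj : j ∈ (β + γ).support) :
    binom β γ = (if j ∈ β.support then binom (β - Finsupp.single j 1) γ else 0) +
      (if j ∈ γ.support then binom β (γ - Finsupp.single j 1) else 0) := by
  classical
  set s := insert j β.support with hs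
  have hjs : j ∈ s := Finset.mem_insert_self _ _
  have h0 : β.support ⊆ s := Finset.subset_insert _ _
  have h1 : (β - Finsupp.single j 1).support ⊆ s := Finsupp.support_tsub.trans h0
  rw [binom_eq_prod h0, binom_eq_prod h1, binom_eq_prod h0, ← Finset.mul_prod_erase s _ hjs,
    ← Finset.mul_prod_erase s _ hjs, ← Finset.mul_prod_erase s _ hjs]
  have e1 : ∀ i ∈ s.erase j, ((β - Finsupp.single j 1 : ℕ →₀ ℕ) i + γ i).choose
      ((β - Finsupp.single j 1 : ℕ →₀ ℕ) i)
      = (β i + γ i).choose (β i) := by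
    intro i hi
    have : j ≠ i := (Finset.ne_of_mem_erase hi).symm
    simp [this]
  have e2 : ∀ i ∈ s.erase j, (β i + (γ - Finsupp.single j 1 : ℕ →₀ ℕ) i).choose (β i)
      = (β i + γ i).choose (β i) := by
    intro i hi
    have : j ≠ i := (Finset.ne_of_mem_erase hi).symm
    simp [this]
  rw [Finset.prod_congr rfl e1, Finset.prod_congr rfl e2]
  simp only [Finsupp.mem_support_iff, Finsupp.coe_add, Pi.add_apply, Finsupp.coe_tsub,
    Pi.sub_apply, Finsupp.single_eq_same] at hj ⊢
  rcases Nat.eq_zero_or_pos (β j) with hb | hb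
  · have hg : γ j ≠ 0 := by omega
    simp [hb, hg]
  · rcases Nat.eq_zero_or_pos (γ j) with hg | hg
    · simp [hg, hb.ne']
    · obtain ⟨b, hb'⟩ := Nat.exists_eq_succ_of_ne_zero hb.ne'
      obtain ⟨g, hg'⟩ := Nat.exists_eq_succ_of_ne_zero hg.ne'
      rw [if_pos hb.ne', if_pos hg.ne', ← add_mul, hb', hg']
      congr 1
      have : b.succ + g.succ = (b + g.succ) + 1 := by omega
      rw [this, Nat.succ_eq_add_one b, Nat.choose_succ_succ]
      simp only [Nat.add_sub_cancel, Nat.succ_eq_add_one]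
      congr 2
      omega

/-- The left side is the pairing of `e w` with the product of the divided monomials of `β` and `γ`;
the place paired with `e` comes from one factor or the other. -/
theorem binom_smul_bracket_cons (e : E) (w : List E) (β γ : ℕ →₀ ℕ) :
    binom β γ • bracket (e :: w) (β + γ) =
      (∑ j ∈ β.support, pair e j * (binom (β - Finsupp.single j 1) γ •
        bracket w (β - Finsupp.single j 1 + γ))) +
      ∑ j ∈ γ.support, pair e j * (binom β (γ - Finsupp.single j 1) •
        bracket w (β + (γ - Finsupp.single j 1))) := by
  classical
  have hβ : β.support ⊆ (β + γ).support := by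
    intro i; simp only [Finsupp.mem_support_iff, Finsupp.coe_add, Pi.add_apply]; omega
  have hγ : γ.support ⊆ (β + γ).support := by
    intro i; simp only [Finsupp.mem_support_iff, Finsupp.coe_add, Pi.add_apply]; omega
  rw [bracket_cons, Finset.smul_sum, ← Finset.inter_eq_right.mpr hβ,
    ← Finset.inter_eq_right.mpr hγ, ← Finset.sum_ite_mem, ← Finset.sum_ite_mem,
    ← Finset.sum_add_distrib]
  refine Finset.sum_congr rfl fun j hj => ?_
  have le_of_mem : ∀ {δ : ℕ →₀ ℕ}, j ∈ δ.support → Finsupp.single j 1 ≤ δ := by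
    intro δ h
    rw [Finsupp.single_le_iff]
    exact Nat.one_le_iff_ne_zero.mpr (Finsupp.mem_support_iff.mp h)
  have h1 : j ∈ β.support → β - Finsupp.single j 1 + γ = β + γ - Finsupp.single j 1 :=
    fun h => tsub_add_eq_add_tsub (le_of_mem h)
  have h2 : j ∈ γ.support → β + (γ - Finsupp.single j 1) = β + γ - Finsupp.single j 1 :=
    fun h => (add_tsub_assoc_of_le (le_of_mem h) β).symm
  rw [binom_pascal β γ j hj, add_smul]
  congr 1
  · split_ifs with h
    · rw [h1 h, mul_smul_comm]
    · simp
  · split_ifs with h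
    · rw [h2 h, mul_smul_comm]
    · simp

/-- Pairing with a product of divided monomials is computed by the coproduct of the word `x`. The
signs come from reordering letters only, so one `ε` serves all `β` and `γ`; this is what allows
summing the identity over splittings. -/
theorem exists_sign_binom_smul_bracket [DecidableEq E] {x : List E} (hx : x.Nodup) :
    ∃ ε : Finset E → ℤ, (∀ A, ε A = 1 ∨ ε A = -1) ∧ ∀ β γ : ℕ →₀ ℕ,
      binom β γ • bracket x (β + γ) = ∑ A ∈ x.toFinset.powerset,
        ε A • (bracket (x.filter (· ∈ A)) β * bracket (x.filter (· ∉ A)) γ) := by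
  induction x with
  | nil =>
    refine ⟨fun _ => 1, fun _ => Or.inl rfl, fun β γ => ?_⟩
    simp only [List.toFinset_nil, Finset.powerset_empty, Finset.sum_singleton, List.filter_nil,
      bracket_nil, one_smul]
    by_cases hβ : β = 0 <;> by_cases hγ : γ = 0 <;> simp [hβ, hγ, binom_zero_zero]
  | cons e x ih =>
    obtain ⟨hex, hx⟩ := List.nodup_cons.mp hx
    obtain ⟨ε, hε, hsum⟩ := ih hx
    -- When `e` lies outside `A`, its pair has to cross the bracket of the `A`-part, one sign for
    -- each letter there.
    refine ⟨fun A => if e ∈ A then ε (A.erase e)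
      else (-1) ^ (x.filter (· ∈ A)).length * ε A, fun A => ?_, fun β γ => ?_⟩
    · dsimp only
      split_ifs
      · exact hε _
      · rcases hε A with h | h <;>
          rcases neg_one_pow_eq_or ℤ (x.filter (· ∈ A)).length with h' | h' <;> simp [h, h']
    · have hex' : e ∉ x.toFinset := by simpa using hex
      rw [List.toFinset_cons, Finset.sum_powerset_insert hex', binom_smul_bracket_cons, add_comm]
      congr 1
      · simp only [hsum, Finset.mul_sum]
        rw [Finset.sum_comm]
        refine Finset.sum_congr rfl fun A hA => ?_
        have heA : e ∉ A := fun h => hex' (Finset.mem_powerset.mp hA h)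
        simp only [heA, if_false, List.filter_cons, decide_false, not_false_eq_true, decide_true,
          if_true, Bool.false_eq_true]
        rw [bracket_cons, Finset.mul_sum, Finset.smul_sum]
        refine Finset.sum_congr rfl fun j _ => ?_
        rw [mul_smul_comm, ← mul_assoc, ← mul_assoc, pair_mul_bracket, smul_mul_assoc, smul_smul,
          mul_comm (ε A)]
      · simp only [hsum, Finset.mul_sum]
        rw [Finset.sum_comm]
        refine Finset.sum_congr rfl fun A hA => ?_
        have heA : e ∉ A := fun h => hex' (Finset.mem_powerset.mp hA h)
        have f1 : x.filter (· ∈ insert e A) = x.filter (· ∈ A) := by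
          refine List.filter_congr fun a ha => ?_
          have : a ≠ e := by rintro rfl; exact hex ha
          simp [this]
        have f2 : x.filter (· ∉ insert e A) = x.filter (· ∉ A) := by
          refine List.filter_congr fun a ha => ?_
          have : a ≠ e := by rintro rfl; exact hex ha
          simp [this]
        simp only [Finset.mem_insert_self, if_true, List.filter_cons, decide_true,
          not_true_eq_false, decide_false, Bool.false_eq_true, if_false, f1, f2,
          Finset.erase_insert heA]
        rw [bracket_cons, Finset.sum_mul, Finset.smul_sum]
        refine Finset.sum_congr rfl fun j _ => ?_
        rw [mul_smul_comm, mul_assoc]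

end

end LetterPlaceAlgebra

/-! ### Exchange identities and straightening of two rows -/

namespace LetterPlaceAlgebra

noncomputable section

variable {E : Type*}

/-- Exchange on the letters: distributing `x` over two rows in all signed ways reassembles it into a
single bracket, hence a longer row when `x` is long. -/
theorem sum_bracket_append_mul_bracket_append [DecidableEq E] {x : List E} {ε : Finset E → ℤ}
    (hε : ∀ β γ : ℕ →₀ ℕ, binom β γ • bracket x (β + γ) = ∑ A ∈ x.toFinset.powerset,
        ε A • (bracket (x.filter (· ∈ A)) β * bracket (x.filter (· ∉ A)) γ))
    (u v : List E) (α₁ α₂ : ℕ →₀ ℕ) :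
    ∑ A ∈ x.toFinset.powerset,
        ε A • (bracket (u ++ x.filter (· ∈ A)) α₁ * bracket (x.filter (· ∉ A) ++ v) α₂) =
      ∑ p ∈ Finset.HasAntidiagonal.antidiagonal α₁, ∑ q ∈ Finset.HasAntidiagonal.antidiagonal α₂,
        binom p.2 q.1 • (bracket u p.1 * bracket x (p.2 + q.1) * bracket v q.2) := by
  simp only [bracket_append, Finset.sum_mul_sum, Finset.smul_sum]
  rw [Finset.sum_comm]
  refine Finset.sum_congr rfl fun p _ => ?_
  rw [Finset.sum_comm]
  refine Finset.sum_congr rfl fun q _ => ?_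
  rw [← smul_mul_assoc, ← mul_smul_comm, hε, Finset.mul_sum, Finset.sum_mul]
  refine Finset.sum_congr rfl fun A _ => ?_
  simp only [mul_smul_comm, smul_mul_assoc, mul_assoc]

/-- Exchange on the places: distributing `η` over two rows in all ways reassembles it in one middle
bracket, whose row is long when `η` has large degree. -/
theorem sum_binom_smul_bracket_mul_bracket [DecidableEq E] {w₁ w₂ : List E} {ε₁ ε₂ : Finset E → ℤ}
    (h₁ : ∀ β γ : ℕ →₀ ℕ, binom β γ • bracket w₁ (β + γ) = ∑ A ∈ w₁.toFinset.powerset,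
        ε₁ A • (bracket (w₁.filter (· ∈ A)) β * bracket (w₁.filter (· ∉ A)) γ))
    (h₂ : ∀ β γ : ℕ →₀ ℕ, binom β γ • bracket w₂ (β + γ) = ∑ A ∈ w₂.toFinset.powerset,
        ε₂ A • (bracket (w₂.filter (· ∈ A)) β * bracket (w₂.filter (· ∉ A)) γ))
    (υ η ν : ℕ →₀ ℕ) :
    ∑ p ∈ Finset.HasAntidiagonal.antidiagonal η,
        (binom υ p.1 • bracket w₁ (υ + p.1)) * (binom p.2 ν • bracket w₂ (p.2 + ν)) =
      ∑ A ∈ w₁.toFinset.powerset, ∑ B ∈ w₂.toFinset.powerset, (ε₁ A * ε₂ B) •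
        (bracket (w₁.filter (· ∈ A)) υ *
          bracket (w₁.filter (· ∉ A) ++ w₂.filter (· ∈ B)) η * bracket (w₂.filter (· ∉ B)) ν) := by
  simp only [h₁, h₂, Finset.sum_mul_sum, bracket_append]
  rw [Finset.sum_comm]
  refine Finset.sum_congr rfl fun A _ => ?_
  rw [Finset.sum_comm]
  refine Finset.sum_congr rfl fun B _ => ?_
  rw [Finset.mul_sum, Finset.sum_mul, Finset.smul_sum]
  refine Finset.sum_congr rfl fun p _ => ?_
  simp only [mul_smul_comm, smul_mul_assoc, mul_assoc, smul_smul]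
  rw [mul_comm]

/-- The sum of the places of a divided monomial, with multiplicity. -/
def moment (α : ℕ →₀ ℕ) : ℕ := α.sum fun i a => a * i

theorem moment_add (α β : ℕ →₀ ℕ) : moment (α + β) = moment α + moment β :=
  Finsupp.sum_add_index' (by simp) (by intros; ring)

/-- Among parts of `y₁ + y₂` of the given degree, `y₁` takes the largest places. With equal degrees,
the difference of moments is the sum of `(y₁ i - β i) (i - m)`, and each term is nonnegative. -/
theorem moment_lt_of_degree_eq {m : ℕ} {y₁ y₂ β γ : ℕ →₀ ℕ} (h₁ : ∀ i, i < m → y₁ i = 0)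
    (h₂ : ∀ i, m < i → y₂ i = 0) (h : β + γ = y₁ + y₂) (hd : β.degree = y₁.degree)
    (hne : β ≠ y₁) : moment β < moment y₁ := by
  classical
  set s := β.support ∪ y₁.support with hs
  have hβs : β.support ⊆ s := Finset.subset_union_left
  have hys : y₁.support ⊆ s := Finset.subset_union_right
  have m1 : moment β = ∑ i ∈ s, β i * i := Finsupp.sum_of_support_subset _ hβs _ (by simp)
  have m2 : moment y₁ = ∑ i ∈ s, y₁ i * i := Finsupp.sum_of_support_subset _ hys _ (by simp)
  have d1 : β.degree = ∑ i ∈ s, β i := Finsupp.sum_of_support_subset β hβs (fun _ a => a) (by simp)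
  have d2 : y₁.degree = ∑ i ∈ s, y₁ i :=
    Finsupp.sum_of_support_subset y₁ hys (fun _ a => a) (by simp)
  have hpt : ∀ i, β i + γ i = y₁ i + y₂ i := fun i => by
    simpa using DFunLike.congr_fun h i
  have hterm : ∀ i, 0 ≤ ((y₁ i : ℤ) - β i) * ((i : ℤ) - m) := by
    intro i
    rcases lt_trichotomy i m with hi | hi | hi
    · have := h₁ i hi
      apply mul_nonneg_of_nonpos_of_nonpos <;> omega
    · simp [hi]
    · have := h₂ i hi
      have := hpt i
      apply mul_nonneg <;> omega
  -- The factor `i - m` vanishes at `m`, so a difference elsewhere is needed; equal degrees rule out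
  -- a difference at `m` alone.
  have hex : ∃ i, i ≠ m ∧ β i ≠ y₁ i := by
    by_contra! hcon
    apply hne
    ext i
    by_cases hi : i = m
    · subst hi
      by_cases his : i ∈ s
      · rw [d1, d2, ← Finset.add_sum_erase s _ his, ← Finset.add_sum_erase s _ his,
          Finset.sum_congr rfl fun j hj => hcon j (Finset.ne_of_mem_erase hj)] at hd
        exact add_right_cancel hd
      · rw [hs, Finset.mem_union, not_or, Finsupp.notMem_support_iff,
          Finsupp.notMem_support_iff] at his
        rw [his.1, his.2]
    · exact hcon i hi
  obtain ⟨i, him, hi⟩ := hex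
  have his : i ∈ s := by
    by_contra hcon
    rw [hs, Finset.mem_union, not_or, Finsupp.notMem_support_iff,
      Finsupp.notMem_support_iff] at hcon
    exact hi (by rw [hcon.1, hcon.2])
  have hpos : 0 < ∑ i ∈ s, ((y₁ i : ℤ) - β i) * ((i : ℤ) - m) := by
    refine Finset.sum_pos' (fun i _ => hterm i) ⟨i, his, lt_of_le_of_ne (hterm i) ?_⟩
    symm
    apply mul_ne_zero <;> omega
  have hexp : ∑ i ∈ s, ((y₁ i : ℤ) - β i) * ((i : ℤ) - m) =
      ((moment y₁ : ℤ) - moment β) - m * ((y₁.degree : ℤ) - β.degree) := by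
    rw [m1, m2, d1, d2]
    push_cast
    rw [← Finset.sum_sub_distrib, ← Finset.sum_sub_distrib, Finset.mul_sum,
      ← Finset.sum_sub_distrib]
    exact Finset.sum_congr rfl fun i _ => by ring
  rw [hexp, hd, sub_self, mul_zero, sub_zero] at hpos
  omega

/-- Straightening two rows on the side of the places. -/
theorem bracket_mul_bracket_mem_of_places [DecidableEq E] (V : Submodule ℤ (LetterPlaceAlgebra E))
    {w₁ w₂ : List E} (hw₁ : w₁.Nodup) (hw₂ : w₂.Nodup) {α₁ α₂ : ℕ →₀ ℕ}
    (hd₁ : α₁.degree = w₁.length) (m : ℕ)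
    (hm : (α₁.filter (· < m)).degree < (α₂.filter (· ≤ m)).degree)
    (lower : ∀ β₁ β₂ : ℕ →₀ ℕ, moment β₁ < moment α₁ →
      moment β₁ + moment β₂ = moment α₁ + moment α₂ → bracket w₁ β₁ * bracket w₂ β₂ ∈ V)
    (longer : ∀ (u x v : List E) (β₁ β₂ β₃ : ℕ →₀ ℕ),
      u.length + x.length + v.length = w₁.length + w₂.length → w₁.length < x.length →
      bracket u β₁ * bracket x β₂ * bracket v β₃ ∈ V) :
    bracket w₁ α₁ * bracket w₂ α₂ ∈ V := by
  obtain ⟨ε₁, -, h₁⟩ := exists_sign_binom_smul_bracket hw₁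
  obtain ⟨ε₂, -, h₂⟩ := exists_sign_binom_smul_bracket hw₂
  set υ := α₁.filter (· < m) with hυ
  set y₁ := α₁.filter (¬ · < m) with hy₁
  set y₂ := α₂.filter (· ≤ m) with hy₂
  set ν := α₂.filter (¬ · ≤ m) with hν
  have e₁ : υ + y₁ = α₁ := Finsupp.filter_add_filter_not _ _
  have e₂ : y₂ + ν = α₂ := Finsupp.filter_add_filter_not _ _
  have key := sum_binom_smul_bracket_mul_bracket h₁ h₂ υ (y₁ + y₂) ν
  have hmem : (y₁, y₂) ∈ Finset.HasAntidiagonal.antidiagonal (y₁ + y₂) :=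
    Finset.HasAntidiagonal.mem_antidiagonal.mpr rfl
  rw [← Finset.add_sum_erase _ _ hmem] at key
  -- Cutting each exponent at a threshold separates supports, so the product to be straightened
  -- occurs with coefficient 1, even when `m` itself is a place of both rows.
  have hb₁ : binom υ y₁ = 1 := binom_of_disjoint fun i => by
    by_cases hi : i < m <;> simp [hυ, hy₁, Finsupp.filter_apply, hi]
  have hb₂ : binom y₂ ν = 1 := binom_of_disjoint fun i => by
    by_cases hi : i ≤ m <;> simp [hy₂, hν, Finsupp.filter_apply, hi]
  simp only [hb₁, hb₂, one_smul, e₁, e₂] at key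
  rw [eq_sub_of_add_eq key]
  refine V.sub_mem (V.sum_mem fun A hA => V.sum_mem fun B hB => V.smul_mem _ ?_)
    (V.sum_mem fun p hp => ?_)
  -- By `hm` the degree of `y₁ + y₂` exceeds that of `υ + y₁ = α₁`, so a nonzero middle bracket is
  -- longer than `w₁`.
  · by_cases hlen : (y₁ + y₂).degree = (w₁.filter (· ∉ A) ++ w₂.filter (· ∈ B)).length
    · refine longer _ _ _ _ _ _ ?_ ?_
      · have l₁ := List.length_eq_length_filter_add (l := w₁) (fun a => decide (a ∈ A))
        have l₂ := List.length_eq_length_filter_add (l := w₂) (fun a => decide (a ∈ B))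
        simp only [← decide_not] at l₁ l₂
        rw [List.length_append]
        omega
      · rw [← hlen, ← hd₁, ← e₁, map_add, map_add]
        omega
    · rw [bracket_of_degree_ne hlen, mul_zero, zero_mul]
      exact V.zero_mem
  · obtain ⟨β, γ⟩ := p
    have hsum : β + γ = y₁ + y₂ :=
      Finset.HasAntidiagonal.mem_antidiagonal.mp (Finset.mem_of_mem_erase hp)
    have hne : β ≠ y₁ := by
      rintro rfl
      exact Finset.ne_of_mem_erase hp (by rw [add_left_cancel hsum])
    rw [smul_mul_assoc, mul_smul_comm]
    refine V.smul_of_tower_mem _ (V.smul_of_tower_mem _ ?_)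
    by_cases hdeg : (υ + β).degree = w₁.length
    · have hlt : moment β < moment y₁ := by
        refine moment_lt_of_degree_eq (m := m) (y₂ := y₂) (γ := γ) ?_ ?_ hsum ?_ hne
        · intro i hi
          simp [hy₁, hi]
        · intro i hi
          simp [hy₂, not_le.mpr hi]
        · rw [← hd₁, ← e₁, map_add, map_add] at hdeg
          omega
      have hms := congrArg moment hsum
      rw [moment_add, moment_add] at hms
      refine lower (υ + β) (γ + ν) ?_ ?_
      · rw [← e₁, moment_add, moment_add]
        omega
      · rw [← e₁, ← e₂, moment_add, moment_add, moment_add, moment_add]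
        omega
    · rw [bracket_of_degree_ne hdeg, zero_mul]
      exact V.zero_mem

variable {n : ℕ}

/-- The sum of the indices of the letters of a word. -/
def wordSum (w : List (Fin n)) : ℕ := (w.map Fin.val).sum

theorem wordSum_append (w w' : List (Fin n)) : wordSum (w ++ w') = wordSum w + wordSum w' := by
  simp [wordSum]

theorem wordSum_perm {w w' : List (Fin n)} (h : w.Perm w') : wordSum w = wordSum w' :=
  (h.map _).sum_eq

/-- The elements lost from `X` are at least `m`, and equally many elements below `m` replace them.
-/
theorem sum_lt_sum_of_card_eq {m : ℕ} {X Y A : Finset (Fin n)} (hX : ∀ i ∈ X, m ≤ i.val)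
    (hY : ∀ i ∈ Y, i.val < m) (hA : A ⊆ Y ∪ X) (hcard : A.card = X.card) (hne : A ≠ X) :
    ∑ i ∈ A, i.val < ∑ i ∈ X, i.val := by
  have h1 : (A \ X).card = (X \ A).card := Finset.card_sdiff_comm hcard
  have hne' : (A \ X).Nonempty := by
    rw [Finset.sdiff_nonempty]
    intro h
    exact hne (Finset.eq_of_subset_of_card_le h hcard.ge)
  have h2 : ∑ i ∈ A \ X, i.val < (A \ X).card * m := by
    rw [← smul_eq_mul, ← Finset.sum_const]
    refine Finset.sum_lt_sum_of_nonempty hne' fun i hi => hY i ?_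
    rw [Finset.mem_sdiff] at hi
    exact (Finset.mem_union.mp (hA hi.1)).resolve_right hi.2
  have h3 : (X \ A).card * m ≤ ∑ i ∈ X \ A, i.val := by
    rw [← smul_eq_mul]
    exact Finset.card_nsmul_le_sum _ _ _ fun i hi => hX i (Finset.mem_sdiff.mp hi).1
  have h4 := Finset.sum_inter_add_sum_sdiff A X Fin.val
  have h5 := Finset.sum_inter_add_sum_sdiff X A Fin.val
  rw [Finset.inter_comm] at h5
  rw [h1] at h2
  omega

theorem filter_append_filter_not_of_sorted {w : List (Fin n)} (hw : w.Pairwise (· < ·)) (m : ℕ) :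
    w.filter (fun a => a.val < m) ++ w.filter (fun a => ¬ a.val < m) = w := by
  induction w with
  | nil => rfl
  | cons a w ih =>
    rw [List.pairwise_cons] at hw
    by_cases ha : a.val < m
    · rw [List.filter_cons_of_pos (by simpa using ha), List.filter_cons_of_neg (by simpa using ha),
        List.cons_append, ih hw.2]
    · have : ∀ b ∈ w, ¬ b.val < m := fun b hb => by
        have := hw.1 b hb
        rw [Fin.lt_def] at this
        omega
      rw [List.filter_cons_of_neg (by simpa using ha), List.filter_cons_of_pos (by simpa using ha),
        List.filter_eq_nil_iff.mpr (by simpa using this), List.nil_append,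
        List.filter_eq_self.mpr (by simpa using this)]

/-- Straightening two rows on the side of the letters. -/
theorem bracket_mul_bracket_mem_of_letters (V : Submodule ℤ (LetterPlaceAlgebra (Fin n)))
    {w₁ w₂ : List (Fin n)} (hw₁ : w₁.Pairwise (· < ·)) (hw₂ : w₂.Pairwise (· < ·))
    {α₁ α₂ : ℕ →₀ ℕ} (hd₁ : α₁.degree = w₁.length) (m : ℕ)
    (hm : (w₁.filter (fun a => a.val < m)).length < (w₂.filter (fun a => a.val < m)).length)
    (lower : ∀ v₁ v₂ : List (Fin n), v₁.length = w₁.length → v₂.length = w₂.length →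
      wordSum v₁ < wordSum w₁ →
      wordSum v₁ + wordSum v₂ = wordSum w₁ + wordSum w₂ → bracket v₁ α₁ * bracket v₂ α₂ ∈ V)
    (longer : ∀ (u x v : List (Fin n)) (β₁ β₂ β₃ : ℕ →₀ ℕ),
      u.length + x.length + v.length = w₁.length + w₂.length → w₁.length < x.length →
      bracket u β₁ * bracket x β₂ * bracket v β₃ ∈ V) :
    bracket w₁ α₁ * bracket w₂ α₂ ∈ V := by
  set u := w₁.filter (fun a => a.val < m) with hu
  set a := w₁.filter (fun a => ¬ a.val < m) with ha
  set b := w₂.filter (fun a => a.val < m) with hb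
  set v := w₂.filter (fun a => ¬ a.val < m) with hv
  have e₁ : u ++ a = w₁ := filter_append_filter_not_of_sorted hw₁ m
  have e₂ : b ++ v = w₂ := filter_append_filter_not_of_sorted hw₂ m
  have ham : ∀ i ∈ a, m ≤ i.val := fun i hi => by simpa using (List.mem_filter.mp hi).2
  have hbm : ∀ i ∈ b, i.val < m := fun i hi => by simpa using (List.mem_filter.mp hi).2
  have hand : a.Nodup := hw₁.nodup.filter _
  have hbnd : b.Nodup := hw₂.nodup.filter _
  have hdisj : List.Disjoint b a := fun i hi hi' => by
    have := ham i hi'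
    have := hbm i hi
    omega
  have hx : (b ++ a).Nodup := hbnd.append hand hdisj
  obtain ⟨ε, hε, hsum⟩ := exists_sign_binom_smul_bracket hx
  have key := sum_bracket_append_mul_bracket_append hsum u v α₁ α₂
  -- This choice puts all large letters back in the first row and returns `w₁` and `w₂`. Any other
  -- choice of the same size puts smaller letters in the first row.
  have hmem : a.toFinset ∈ (b ++ a).toFinset.powerset := by
    rw [Finset.mem_powerset, List.toFinset_append]
    exact Finset.subset_union_right
  have fa : (b ++ a).filter (· ∈ a.toFinset) = a := by
    rw [List.filter_append, List.filter_eq_nil_iff.mpr, List.filter_eq_self.mpr, List.nil_append]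
    · intro i hi
      simpa using hi
    · intro i hi
      simpa using fun h => hdisj hi h
  have fb : (b ++ a).filter (· ∉ a.toFinset) = b := by
    rw [List.filter_append, List.filter_eq_self.mpr, List.filter_eq_nil_iff.mpr, List.append_nil]
    · intro i hi
      simpa using hi
    · intro i hi
      simpa using fun h => hdisj hi h
  rw [← Finset.add_sum_erase _ _ hmem, fa, fb, e₁, e₂] at key
  have hmain : ε a.toFinset • (bracket w₁ α₁ * bracket w₂ α₂) ∈ V := by
    rw [eq_sub_of_add_eq key]
    refine V.sub_mem (V.sum_mem fun p _ => V.sum_mem fun q _ => V.smul_of_tower_mem _ ?_)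
      (V.sum_mem fun A hA => V.smul_mem _ ?_)
    · refine longer _ _ _ _ _ _ ?_ ?_
      · rw [← e₁, ← e₂]
        simp only [List.length_append]
        omega
      · rw [← e₁]
        simp only [List.length_append]
        omega
    · have hAsub : A ⊆ (b ++ a).toFinset := Finset.mem_powerset.mp (Finset.mem_of_mem_erase hA)
      have hfA : ((b ++ a).filter (· ∈ A)).toFinset = A := by
        ext i
        simp only [List.mem_toFinset, List.mem_filter, decide_eq_true_eq]
        exact ⟨fun h => h.2, fun h => ⟨List.mem_toFinset.mp (hAsub h), h⟩⟩
      have hperm : ((b ++ a).filter (· ∈ A) ++ (b ++ a).filter (· ∉ A)).Perm (b ++ a) := by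
        have := List.filter_append_perm (fun i => decide (i ∈ A)) (b ++ a)
        simpa only [← decide_not] using this
      have hlen := hperm.length_eq
      have hws := wordSum_perm hperm
      simp only [List.length_append, wordSum_append] at hlen hws
      by_cases hdeg : α₁.degree = (u ++ (b ++ a).filter (· ∈ A)).length
      · have hl : ((b ++ a).filter (· ∈ A)).length = a.length := by
          rw [hd₁, ← e₁, List.length_append, List.length_append] at hdeg
          omega
        have hlt : wordSum ((b ++ a).filter (· ∈ A)) < wordSum a := by
          have h1 : wordSum ((b ++ a).filter (· ∈ A)) = ∑ i ∈ A, i.val := by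
            conv_rhs => rw [← hfA]
            exact (List.sum_toFinset _ (hx.filter _)).symm
          have h2 : wordSum a = ∑ i ∈ a.toFinset, i.val :=
            (List.sum_toFinset _ hand).symm
          rw [h1, h2]
          refine sum_lt_sum_of_card_eq (m := m) (Y := b.toFinset) ?_ ?_ ?_ ?_
            (Finset.ne_of_mem_erase hA)
          · simpa using ham
          · simpa using hbm
          · rw [← List.toFinset_append]
            exact hAsub
          · rw [List.toFinset_card_of_nodup hand, ← hl, ← List.toFinset_card_of_nodup (hx.filter _),
              hfA]
        refine lower _ _ ?_ ?_ ?_ ?_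
        · rw [← e₁, List.length_append, List.length_append, hl]
        · rw [← e₂, List.length_append, List.length_append]
          omega
        · rw [← e₁, wordSum_append, wordSum_append]
          omega
        · rw [← e₁, ← e₂]
          simp only [wordSum_append]
          omega
      · rw [bracket_of_degree_ne hdeg, zero_mul]
        exact V.zero_mem
  rcases hε a.toFinset with h | h
  · simpa [h] using hmain
  · simpa [h] using hmain

end

end LetterPlaceAlgebra

/-! ### The straightening algorithm for lists of rows -/

namespace LetterPlaceAlgebra

noncomputable section

variable {n : ℕ}

/-- The product of the brackets `(w|p^{(α)})` of a list of rows `(w, α)`. -/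
def rowsProd (L : List (List (Fin n) × (ℕ →₀ ℕ))) : LetterPlaceAlgebra (Fin n) :=
  (L.map fun r => bracket r.1 r.2).prod

/-- The total number of cells of a list of rows. -/
def rowsSize (L : List (List (Fin n) × (ℕ →₀ ℕ))) : ℕ := (L.map fun r => r.1.length).sum

/-- A measure of the shape of a list of rows, which grows in the dominance order. -/
def shapeWeight (L : List (List (Fin n) × (ℕ →₀ ℕ))) : ℕ :=
  (L.map fun r => 2 ^ r.1.length - 1).sum

/-- The sum of all entries of a list of rows, the entries of a row being counted once for each row
that does not come before it. -/
def rowsWeight : List (List (Fin n) × (ℕ →₀ ℕ)) → ℕ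
  | [] => 0
  | r :: L => rowsWeight L + (L.length + 1) * (wordSum r.1 + moment r.2)

theorem rowsProd_cons (r : List (Fin n) × (ℕ →₀ ℕ)) (L : List (List (Fin n) × (ℕ →₀ ℕ))) :
    rowsProd (r :: L) = bracket r.1 r.2 * rowsProd L := by simp [rowsProd]

theorem rowsProd_append (L L' : List (List (Fin n) × (ℕ →₀ ℕ))) :
    rowsProd (L ++ L') = rowsProd L * rowsProd L' := by simp [rowsProd]

theorem rowsProd_perm {L L' : List (List (Fin n) × (ℕ →₀ ℕ))} (h : L.Perm L') :
    rowsProd L = rowsProd L' ∨ rowsProd L = -rowsProd L' := by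
  induction h with
  | nil => exact Or.inl rfl
  | cons r _ ih =>
    rw [rowsProd_cons, rowsProd_cons]
    rcases ih with ih | ih <;> simp [ih]
  | swap r s l =>
    rw [rowsProd_cons, rowsProd_cons, rowsProd_cons, rowsProd_cons, ← mul_assoc, ← mul_assoc,
      bracket_mul_bracket]
    rcases neg_one_pow_eq_or ℤ (s.1.length * r.1.length) with h | h <;> simp [h]
  | trans _ _ ih ih' => rcases ih with ih | ih <;> rcases ih' with ih' | ih' <;> simp [ih, ih']

theorem rowsProd_eq_zero {L : List (List (Fin n) × (ℕ →₀ ℕ))} {r : List (Fin n) × (ℕ →₀ ℕ)}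
    (hr : r ∈ L) (h : bracket r.1 r.2 = 0) : rowsProd L = 0 :=
  List.prod_eq_zero (List.mem_map.mpr ⟨r, hr, h⟩)

/-- For a fixed number of cells the shape weight is bounded, so it can increase only finitely often.
-/
theorem shapeWeight_lt (L : List (List (Fin n) × (ℕ →₀ ℕ))) :
    shapeWeight L < 2 ^ rowsSize L := by
  induction L with
  | nil => simp [shapeWeight, rowsSize]
  | cons r L ih =>
    simp only [shapeWeight, rowsSize, List.map_cons, List.sum_cons, pow_add] at ih ⊢
    have h1 : 1 ≤ 2 ^ r.1.length := Nat.one_le_two_pow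
    obtain ⟨a, ha⟩ := Nat.exists_eq_add_of_le h1
    rw [ha, Nat.add_sub_cancel_left, add_mul, one_mul]
    have := Nat.le_mul_of_pos_right a (Nat.zero_lt_of_lt ih)
    omega

/-- An earlier row is counted more often, so moving part of its entry sum to the next row lowers the
weight. -/
theorem rowsWeight_lt {r₁ r₂ s₁ s₂ : List (Fin n) × (ℕ →₀ ℕ)}
    (L L' : List (List (Fin n) × (ℕ →₀ ℕ)))
    (hlt : wordSum s₁.1 + moment s₁.2 < wordSum r₁.1 + moment r₁.2)
    (heq : wordSum s₁.1 + moment s₁.2 + (wordSum s₂.1 + moment s₂.2) =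
      wordSum r₁.1 + moment r₁.2 + (wordSum r₂.1 + moment r₂.2)) :
    rowsWeight (L ++ s₁ :: s₂ :: L') < rowsWeight (L ++ r₁ :: r₂ :: L') := by
  induction L with
  | nil =>
    simp only [List.nil_append, rowsWeight, List.length_cons]
    nlinarith
  | cons r L ih =>
    simp only [List.cons_append, rowsWeight, List.length_append, List.length_cons]
    omega

/-- The rows of standard tableaux. -/
def IsStandardRow (r : List (Fin n) × (ℕ →₀ ℕ)) : Prop :=
  r.1.Pairwise (· < ·) ∧ r.2.degree = r.1.length ∧ r.1 ≠ []

/-- The relation between consecutive rows of standard tableaux: the entries of the words increase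
weakly, and the places increase strictly, from one row to the next. -/
def IsStandardPair (r s : List (Fin n) × (ℕ →₀ ℕ)) : Prop :=
  s.1.length ≤ r.1.length ∧
  (∀ m, (s.1.filter (fun a => a.val < m)).length ≤ (r.1.filter (fun a => a.val < m)).length) ∧
  ∀ m, (s.2.filter (· ≤ m)).degree ≤ (r.2.filter (· < m)).degree

theorem exists_not_of_not_isChain {α : Type*} {R : α → α → Prop} {L : List α}
    (h : ¬L.IsChain R) : ∃ (L₁ L₂ : List α) (a b : α), L = L₁ ++ a :: b :: L₂ ∧ ¬R a b := by
  induction L with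
  | nil => simp at h
  | cons a L ih =>
    cases L with
    | nil => simp at h
    | cons b L =>
      by_cases hab : R a b
      · rw [List.isChain_cons_cons, not_and] at h
        obtain ⟨L₁, L₂, c, d, hL, hcd⟩ := ih (h hab)
        exact ⟨a :: L₁, L₂, c, d, by rw [hL, List.cons_append], hcd⟩
      · exact ⟨[], L, a, b, rfl, hab⟩

/-- One straightening step at the first pair of consecutive rows in bad position; both kinds of
resulting terms are covered by the hypotheses `longer` and `lower`. -/
theorem rowsProd_mem_of_sorted_rows (V : Submodule ℤ (LetterPlaceAlgebra (Fin n)))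
    (hV : ∀ L, (∀ r ∈ L, IsStandardRow r) → L.IsChain IsStandardPair → rowsProd L ∈ V)
    (L : List (List (Fin n) × (ℕ →₀ ℕ)))
    (longer : ∀ L', rowsSize L' = rowsSize L → shapeWeight L < shapeWeight L' → rowsProd L' ∈ V)
    (lower : ∀ L' : List (List (Fin n) × (ℕ →₀ ℕ)), L'.map (fun r => r.1.length) =
      L.map (fun r => r.1.length) → rowsWeight L' < rowsWeight L → rowsProd L' ∈ V)
    (hlen : L.Pairwise fun r s => s.1.length ≤ r.1.length)
    (hrow : ∀ r ∈ L, IsStandardRow r) : rowsProd L ∈ V := by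
  by_cases hc : L.IsChain IsStandardPair
  · exact hV L hrow hc
  obtain ⟨L₁, L₂, r₁, r₂, rfl, hbad⟩ := exists_not_of_not_isChain hc
  have hr₁ := hrow r₁ (by simp)
  have hr₂ := hrow r₂ (by simp)
  have hle : r₂.1.length ≤ r₁.1.length := by
    rw [List.pairwise_append] at hlen
    exact (List.pairwise_cons.mp hlen.2.1).1 r₂ (by simp)
  -- Multiplication by the surrounding rows; the two-row lemmas are applied to the preimage of `V`
  -- under it.
  let f : LetterPlaceAlgebra (Fin n) →ₗ[ℤ] LetterPlaceAlgebra (Fin n) :=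
    (LinearMap.mulLeft ℤ (rowsProd L₁)).comp (LinearMap.mulRight ℤ (rowsProd L₂))
  have hf : ∀ z, z ∈ V.comap f ↔ rowsProd L₁ * (z * rowsProd L₂) ∈ V := fun z => Iff.rfl
  have htwo : ∀ s₁ s₂ : List (Fin n) × (ℕ →₀ ℕ),
      bracket s₁.1 s₁.2 * bracket s₂.1 s₂.2 ∈ V.comap f ↔
        rowsProd (L₁ ++ s₁ :: s₂ :: L₂) ∈ V := by
    intro s₁ s₂
    rw [hf, rowsProd_append, rowsProd_cons, rowsProd_cons, mul_assoc]
  have hlonger : ∀ (u x v : List (Fin n)) (β₁ β₂ β₃ : ℕ →₀ ℕ),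
      u.length + x.length + v.length = r₁.1.length + r₂.1.length → r₁.1.length < x.length →
      bracket u β₁ * bracket x β₂ * bracket v β₃ ∈ V.comap f := by
    intro u x v β₁ β₂ β₃ h1 h2
    have := longer (L₁ ++ (u, β₁) :: (x, β₂) :: (v, β₃) :: L₂) ?_ ?_
    · rw [hf]
      simpa only [rowsProd_append, rowsProd_cons, mul_assoc] using this
    · simp only [rowsSize, List.map_append, List.map_cons, List.sum_append, List.sum_cons]
      omega
    · simp only [shapeWeight, List.map_append, List.map_cons, List.sum_append, List.sum_cons]
      -- A row longer than the longer of two rows outweighs both together; this is why row lengths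
      -- are weighted by powers of 2.
      have p1 : 2 ^ (r₁.1.length + 1) ≤ 2 ^ x.length := Nat.pow_le_pow_right (by norm_num) h2
      have p2 : 2 ^ r₂.1.length ≤ 2 ^ r₁.1.length := Nat.pow_le_pow_right (by norm_num) hle
      have p3 : 1 ≤ 2 ^ r₂.1.length := Nat.one_le_two_pow
      rw [pow_succ] at p1
      omega
  rw [← htwo]
  by_cases hp : ∀ m, (r₂.2.filter (· ≤ m)).degree ≤ (r₁.2.filter (· < m)).degree
  · obtain ⟨m, hm⟩ : ∃ m, (r₁.1.filter (fun a => a.val < m)).length <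
        (r₂.1.filter (fun a => a.val < m)).length := by
      by_contra! hcon
      exact hbad ⟨hle, hcon, hp⟩
    refine bracket_mul_bracket_mem_of_letters _ hr₁.1 hr₂.1 hr₁.2.1 m hm ?_ hlonger
    intro v₁ v₂ hl₁ hl₂ hlt heq
    refine (htwo (v₁, r₁.2) (v₂, r₂.2)).mpr (lower _ ?_ (rowsWeight_lt _ _ ?_ ?_))
    · simp [hl₁, hl₂]
    · simpa using hlt
    · simp only
      omega
  · push Not at hp
    obtain ⟨m, hm⟩ := hp
    refine bracket_mul_bracket_mem_of_places _ hr₁.1.nodup hr₂.1.nodup hr₁.2.1 m hm ?_ hlonger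
    intro β₁ β₂ hlt heq
    refine (htwo (r₁.1, β₁) (r₂.1, β₂)).mpr (lower _ ?_ (rowsWeight_lt _ _ ?_ ?_))
    · simp
    · simpa using hlt
    · simp only
      omega

theorem rowsProd_sort (L : List (List (Fin n) × (ℕ →₀ ℕ))) :
    rowsProd L = rowsProd (L.map fun r => (r.1.insertionSort (· ≤ ·), r.2)) ∨
      rowsProd L = -rowsProd (L.map fun r => (r.1.insertionSort (· ≤ ·), r.2)) := by
  induction L with
  | nil => exact Or.inl rfl
  | cons r L ih =>
    rw [List.map_cons, rowsProd_cons, rowsProd_cons]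
    rcases bracket_perm (List.perm_insertionSort (· ≤ ·) r.1).symm r.2 with h | h <;>
      rcases ih with ih | ih <;> simp [h, ih]

theorem rowsWeight_sort (L : List (List (Fin n) × (ℕ →₀ ℕ))) :
    rowsWeight (L.map fun r => (r.1.insertionSort (· ≤ ·), r.2)) = rowsWeight L := by
  induction L with
  | nil => rfl
  | cons r L ih =>
    rw [List.map_cons, rowsWeight, rowsWeight, ih, List.length_map,
      wordSum_perm (List.perm_insertionSort (· ≤ ·) r.1)]

/-- The inner induction, at fixed row lengths, on the weight of the entries; terms of larger shape
are left to `longer`. -/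
theorem rowsProd_mem_of_sorted_lengths (V : Submodule ℤ (LetterPlaceAlgebra (Fin n)))
    (hV : ∀ L, (∀ r ∈ L, IsStandardRow r) → L.IsChain IsStandardPair → rowsProd L ∈ V) (k : ℕ) :
    ∀ L : List (List (Fin n) × (ℕ →₀ ℕ)), rowsWeight L = k →
    (∀ L', rowsSize L' = rowsSize L → shapeWeight L < shapeWeight L' → rowsProd L' ∈ V) →
    (L.Pairwise fun r s => s.1.length ≤ r.1.length) → (∀ r ∈ L, r.1 ≠ []) →
    rowsProd L ∈ V := by
  induction k using Nat.strong_induction_on with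
  | _ k ih =>
  intro L hk longer hlen hne
  by_cases hdeg : ∃ r ∈ L, r.2.degree ≠ r.1.length
  · obtain ⟨r, hr, hd⟩ := hdeg
    rw [rowsProd_eq_zero hr (bracket_of_degree_ne hd)]
    exact V.zero_mem
  by_cases hnd : ∃ r ∈ L, ¬r.1.Nodup
  · obtain ⟨r, hr, hd⟩ := hnd
    rw [rowsProd_eq_zero hr (bracket_of_not_nodup hd _)]
    exact V.zero_mem
  push Not at hdeg hnd
  -- Sorting each word costs only a sign and changes neither lengths nor weights.
  set K := L.map fun r => (r.1.insertionSort (· ≤ ·), r.2) with hK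
  have hmap : K.map (fun r => r.1.length) = L.map (fun r => r.1.length) := by
    rw [hK, List.map_map]
    exact List.map_congr_left fun r _ => (List.perm_insertionSort (· ≤ ·) r.1).length_eq
  have size_eq : ∀ {L L' : List (List (Fin n) × (ℕ →₀ ℕ))}, L'.map (fun r => r.1.length) =
      L.map (fun r => r.1.length) → rowsSize L' = rowsSize L := fun h => congrArg List.sum h
  have shape_eq : ∀ {L L' : List (List (Fin n) × (ℕ →₀ ℕ))}, L'.map (fun r => r.1.length) =
      L.map (fun r => r.1.length) → shapeWeight L' = shapeWeight L := fun h => by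
    have := congrArg (fun l => (l.map fun a => 2 ^ a - 1).sum) h
    simpa [shapeWeight, Function.comp_def] using this
  have sorted_of : ∀ {L L' : List (List (Fin n) × (ℕ →₀ ℕ))}, L'.map (fun r => r.1.length) =
      L.map (fun r => r.1.length) → (L.Pairwise fun r s => s.1.length ≤ r.1.length) →
      L'.Pairwise fun r s => s.1.length ≤ r.1.length := fun {L L'} h hL => by
    have h1 : (L.map (fun r => r.1.length)).Pairwise (· ≥ ·) := List.pairwise_map.mpr hL
    rw [← h] at h1
    exact List.pairwise_map.mp h1
  have ne_of : ∀ {L L' : List (List (Fin n) × (ℕ →₀ ℕ))}, L'.map (fun r => r.1.length) =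
      L.map (fun r => r.1.length) → (∀ r ∈ L, r.1 ≠ []) → ∀ r ∈ L', r.1 ≠ [] :=
    fun {L L'} h hL r hr h0 => by
      have h1 : r.1.length ∈ L'.map (fun r => r.1.length) := List.mem_map_of_mem hr
      rw [h] at h1
      obtain ⟨s, hs, hs'⟩ := List.mem_map.mp h1
      rw [h0, List.length_nil, List.length_eq_zero_iff] at hs'
      exact hL s hs hs'
  have hKmem : rowsProd K ∈ V := by
    refine rowsProd_mem_of_sorted_rows V hV K ?_ ?_ (sorted_of hmap hlen) ?_
    · intro L' h1 h2
      rw [size_eq hmap] at h1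
      rw [shape_eq hmap] at h2
      exact longer L' h1 h2
    · intro L' h1 h2
      rw [hK, rowsWeight_sort, hk] at h2
      have h3 := h1.trans hmap
      refine ih _ h2 L' rfl ?_ (sorted_of h3 hlen) (ne_of h3 hne)
      rw [size_eq h3, shape_eq h3]
      exact longer
    · intro r hr
      refine ⟨?_, ?_, ne_of hmap hne r hr⟩
      · obtain ⟨s, hs, rfl⟩ := List.mem_map.mp hr
        have h1 : (s.1.insertionSort (· ≤ ·)).Nodup :=
          (List.perm_insertionSort (· ≤ ·) s.1).nodup_iff.mpr (hnd s hs)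
        have h2 : (s.1.insertionSort (· ≤ ·)).Pairwise (· ≤ ·) :=
          List.pairwise_insertionSort (· ≤ ·) s.1
        exact (h2.and h1).imp fun h => lt_of_le_of_ne h.1 h.2
      · obtain ⟨s, hs, rfl⟩ := List.mem_map.mp hr
        simp only [hdeg s hs, (List.perm_insertionSort (· ≤ ·) s.1).length_eq]
  rcases rowsProd_sort L with h | h
  · rw [h]
    exact hKmem
  · rw [h]
    exact V.neg_mem hKmem

theorem rowsProd_filter_ne_nil (L : List (List (Fin n) × (ℕ →₀ ℕ))) :
    rowsProd L = 0 ∨ rowsProd L = rowsProd (L.filter fun r => r.1 ≠ []) := by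
  induction L with
  | nil => exact Or.inr rfl
  | cons r L ih =>
    obtain ⟨w, α⟩ := r
    by_cases hw : w = []
    · subst hw
      rw [rowsProd_cons, bracket_nil, List.filter_cons_of_neg (by simp)]
      split_ifs
      · simpa using ih
      · simp
    · rw [List.filter_cons_of_pos (by simpa using hw), rowsProd_cons, rowsProd_cons]
      rcases ih with ih | ih
      · simp [ih]
      · exact Or.inr (by rw [ih])

theorem sum_map_filter_ne_nil (g : ℕ → ℕ) (hg : g 0 = 0) (L : List (List (Fin n) × (ℕ →₀ ℕ))) :
    ((L.filter fun r => r.1 ≠ []).map fun r => g r.1.length).sum =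
      (L.map fun r => g r.1.length).sum := by
  induction L with
  | nil => rfl
  | cons r L ih =>
    by_cases hw : r.1 = []
    · rw [List.filter_cons_of_neg (by simpa using hw), ih, List.map_cons, List.sum_cons, hw]
      simp [hg]
    · rw [List.filter_cons_of_pos (by simpa using hw), List.map_cons, List.sum_cons, ih,
        List.map_cons, List.sum_cons]

/-- The straightening law: the products of the rows of standard tableaux span all products of
brackets. -/
theorem rowsProd_mem (V : Submodule ℤ (LetterPlaceAlgebra (Fin n)))
    (hV : ∀ L, (∀ r ∈ L, IsStandardRow r) → L.IsChain IsStandardPair → rowsProd L ∈ V)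
    (L : List (List (Fin n) × (ℕ →₀ ℕ))) : rowsProd L ∈ V := by
  -- The outer induction: the distance of the shape weight from its bound. Empty rows have shape
  -- weight 0, so dropping them keeps it.
  induction hk : 2 ^ rowsSize L - shapeWeight L using Nat.strong_induction_on generalizing L with
  | _ k ih =>
  rcases rowsProd_filter_ne_nil L with h | h
  · rw [h]
    exact V.zero_mem
  set K := L.filter fun r => r.1 ≠ [] with hK
  let le : List (Fin n) × (ℕ →₀ ℕ) → List (Fin n) × (ℕ →₀ ℕ) → Prop :=
    fun r s => s.1.length ≤ r.1.length
  have : DecidableRel le := fun r s => inferInstanceAs (Decidable (s.1.length ≤ r.1.length))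
  have : Std.Total le := ⟨fun r s => le_total s.1.length r.1.length⟩
  have : IsTrans _ le := ⟨fun r s t h h' => h'.trans h⟩
  have hperm := List.perm_insertionSort le K
  have hsize : rowsSize (K.insertionSort le) = rowsSize L :=
    ((hperm.map _).sum_eq).trans (sum_map_filter_ne_nil (fun a => a) rfl L)
  have hshape : shapeWeight (K.insertionSort le) = shapeWeight L :=
    ((hperm.map _).sum_eq).trans (sum_map_filter_ne_nil (fun a => 2 ^ a - 1) rfl L)
  have hmem : rowsProd (K.insertionSort le) ∈ V := by
    refine rowsProd_mem_of_sorted_lengths V hV _ _ rfl ?_ (List.pairwise_insertionSort le K) ?_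
    · intro L' h1 h2
      rw [hsize] at h1
      rw [hshape] at h2
      refine ih _ ?_ L' rfl
      have := shapeWeight_lt L'
      rw [h1] at this ⊢
      omega
    · intro r hr
      have := hperm.mem_iff.mp hr
      rw [hK, List.mem_filter] at this
      simpa using this.2
  rw [h]
  rcases rowsProd_perm hperm with h' | h'
  · rwa [← h']
  · rw [h'] at hmem
    simpa using hmem

/-- The products of brackets span the letter-place algebra. -/
theorem eq_top_of_rowsProd_mem (V : Submodule ℤ (LetterPlaceAlgebra (Fin n)))
    (hV : ∀ L, rowsProd L ∈ V) : V = ⊤ := by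
  have hle : Submodule.span ℤ (Set.range (rowsProd (n := n))) ≤ V :=
    Submodule.span_le.mpr (by rintro _ ⟨L, rfl⟩; exact hV L)
  rw [eq_top_iff]
  refine le_trans (fun z _ => ?_) hle
  set W := Submodule.span ℤ (Set.range (rowsProd (n := n))) with hW
  have hmem : ∀ L, rowsProd L ∈ W := fun L => Submodule.subset_span ⟨L, rfl⟩
  induction z using ExteriorAlgebra.induction with
  | algebraMap r =>
    rw [Algebra.algebraMap_eq_smul_one]
    exact W.smul_mem _ (hmem [])
  | ι v =>
    induction v using Finsupp.induction_linear with
    | zero =>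
      rw [map_zero]
      exact W.zero_mem
    | add v v' h h' =>
      rw [map_add]
      exact W.add_mem (h trivial) (h' trivial)
    | single p a =>
      have h1 : ExteriorAlgebra.ι ℤ (Finsupp.single p a) =
          a • rowsProd [([p.1], Finsupp.single p.2 1)] := by
        rw [rowsProd_cons]
        have : bracket [p.1] (Finsupp.single p.2 1) = pair p.1 p.2 := by
          rw [bracket, word_cons]
          simpa [word] using laplace_letter_single p.1 p.2
        rw [this, pair, rowsProd, List.map_nil, List.prod_nil, mul_one, ← map_smul,
          Finsupp.smul_single, smul_eq_mul, mul_one]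
      rw [h1]
      exact W.smul_mem _ (hmem _)
  | mul a b ha hb =>
    have h1 : a * b ∈ W * W := Submodule.mul_mem_mul (ha trivial) (hb trivial)
    refine (?_ : W * W ≤ W) h1
    rw [hW, Submodule.span_mul_span, Submodule.span_le]
    rintro _ ⟨_, ⟨L, rfl⟩, _, ⟨L', rfl⟩, rfl⟩
    exact Submodule.subset_span ⟨L ++ L', rowsProd_append L L'⟩
  | add a b ha hb => exact W.add_mem (ha trivial) (hb trivial)

end

end LetterPlaceAlgebra

/-! ### From lists of standard rows to pairs of tableaux -/

namespace LetterPlaceAlgebra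

noncomputable section

variable {n : ℕ}

/-- The exponent of the divided monomial that corresponds to a list of places. -/
def content (l : List ℕ) : ℕ →₀ ℕ := (l.map fun j => Finsupp.single j 1).sum

theorem content_cons (j : ℕ) (l : List ℕ) : content (j :: l) = Finsupp.single j 1 + content l := by
  simp [content]

theorem content_eq_toFinsupp (l : List ℕ) : content l = Multiset.toFinsupp (l : Multiset ℕ) := by
  induction l with
  | nil => simp [content]
  | cons j l ih => rw [content_cons, ih, ← Multiset.cons_coe, ← Multiset.singleton_add, map_add,
      Multiset.toFinsupp_singleton]

theorem content_eq_content_iff {l l' : List ℕ} : content l = content l' ↔ l.Perm l' := by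
  rw [content_eq_toFinsupp, content_eq_toFinsupp, EmbeddingLike.apply_eq_iff_eq,
    Multiset.coe_eq_coe]

theorem degree_filter_content (p : ℕ → Prop) [DecidablePred p] (l : List ℕ) :
    ((content l).filter p).degree = (l.filter (fun a => p a)).length := by
  induction l with
  | nil =>
    have : content [] = 0 := rfl
    rw [this, Finsupp.filter_zero, map_zero, List.filter_nil, List.length_nil]
  | cons j l ih =>
    rw [content_cons, Finsupp.filter_add, map_add, ih]
    by_cases hj : p j
    · rw [Finsupp.filter_single_of_pos _ hj, List.filter_cons_of_pos (by simpa using hj),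
        Finsupp.degree_single, List.length_cons, add_comm]
    · rw [Finsupp.filter_single_of_neg _ hj, List.filter_cons_of_neg (by simpa using hj),
        map_zero, zero_add]

theorem degree_content (l : List ℕ) : (content l).degree = l.length := by
  induction l with
  | nil => simp [content]
  | cons j l ih => rw [content_cons, map_add, ih, Finsupp.degree_single, List.length_cons, add_comm]

/-- The places of a divided monomial in weakly increasing order. -/
def places (α : ℕ →₀ ℕ) : List ℕ := (Finsupp.toMultiset α).sort (· ≤ ·)

theorem content_places (α : ℕ →₀ ℕ) : content (places α) = α := by
  rw [content_eq_toFinsupp, places, Multiset.sort_eq, Finsupp.toMultiset_toFinsupp]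

theorem length_places (α : ℕ →₀ ℕ) : (places α).length = α.degree := by
  rw [← degree_content, content_places]

theorem pairwise_places (α : ℕ →₀ ℕ) : (places α).Pairwise (· ≤ ·) :=
  Multiset.pairwise_sort _ _

/-- Entries below `m` form an initial segment; this turns the counting conditions of
`IsStandardPair` into entrywise inequalities. -/
theorem getElem_lt_iff_of_sorted {l : List ℕ} (hl : l.Pairwise (· ≤ ·)) (m j : ℕ)
    (hj : j < l.length) : l[j] < m ↔ j < (l.filter (fun a => a < m)).length := by
  induction l generalizing j with
  | nil => simp at hj
  | cons a l ih =>
    rw [List.pairwise_cons] at hl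
    by_cases ha : a < m
    · rw [List.filter_cons_of_pos (by simpa using ha), List.length_cons]
      cases j with
      | zero => simpa using ha
      | succ j =>
        rw [List.getElem_cons_succ, ih hl.2 j (by simpa using hj)]
        omega
    · have h0 : ∀ b ∈ a :: l, ¬b < m := by
        intro b hb
        rcases List.mem_cons.mp hb with rfl | hb
        · exact ha
        · have := hl.1 b hb
          omega
      rw [List.filter_eq_nil_iff.mpr (by simpa using h0)]
      simpa using h0 _ (List.getElem_mem hj)

theorem IsStandardPair.getElem_word_le {r s : List (Fin n) × (ℕ →₀ ℕ)} (h : IsStandardPair r s)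
    (hr : IsStandardRow r) (hs : IsStandardRow s) (j : ℕ) (hj : j < r.1.length)
    (hj' : j < s.1.length) : r.1[j] ≤ s.1[j] := by
  have key : ∀ {w : List (Fin n)}, w.Pairwise (· < ·) → ∀ (m : ℕ) (hj : j < w.length),
      w[j].val < m ↔ j < (w.filter (fun a => a.val < m)).length := by
    intro w hw m hj
    have h1 : (w.map Fin.val).Pairwise (· ≤ ·) :=
      List.pairwise_map.mpr (hw.imp fun h => le_of_lt h)
    have h2 := getElem_lt_iff_of_sorted h1 m j (by simpa using hj)
    rw [List.getElem_map, List.filter_map] at h2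
    exact h2.trans (by rw [List.length_map]; rfl)
  have h1 := (key hs.1 (s.1[j].val + 1) hj').mp (Nat.lt_succ_self _)
  have h2 := (key hr.1 (s.1[j].val + 1) hj).mpr (h1.trans_le (h.2.1 _))
  exact Fin.le_def.mpr (Nat.lt_succ_iff.mp h2)

theorem IsStandardPair.getElem_places_lt {r s : List (Fin n) × (ℕ →₀ ℕ)} (h : IsStandardPair r s)
    (j : ℕ) (hj : j < (places r.2).length) (hj' : j < (places s.2).length) :
    (places r.2)[j] < (places s.2)[j] := by
  have h1 := (getElem_lt_iff_of_sorted (pairwise_places s.2) ((places s.2)[j] + 1) j hj').mp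
    (Nat.lt_succ_self _)
  rw [getElem_lt_iff_of_sorted (pairwise_places r.2) _ j hj, ← degree_filter_content,
    content_places]
  refine lt_of_lt_of_le h1 ?_
  have h2 := degree_filter_content (· ≤ (places s.2)[j]) (places s.2)
  rw [content_places] at h2
  have h3 := h.2.2 ((places s.2)[j])
  rw [h2] at h3
  simpa only [Nat.lt_succ_iff] using h3

/-- Column conditions of tableaux compare any two rows, while straightening controls consecutive
ones only. -/
theorem IsStandardPair.trans {r s t : List (Fin n) × (ℕ →₀ ℕ)} (h : IsStandardPair r s)
    (h' : IsStandardPair s t) : IsStandardPair r t := by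
  refine ⟨h'.1.trans h.1, fun m => (h'.2.1 m).trans (h.2.1 m), fun m => ?_⟩
  refine ((h'.2.2 m).trans ?_).trans (h.2.2 m)
  rw [← content_places s.2, degree_filter_content, degree_filter_content]
  refine (List.monotone_filter_right _ fun a => ?_).length_le
  simpa using le_of_lt

theorem rowContent_eq_content {μ : YoungDiagram} (S : SemistandardYoungTableau μ) (i : ℕ) :
    S.rowContent i = content (List.ofFn fun j : Fin (μ.rowLen i) => S i j) := by
  rw [content, List.map_ofFn, List.sum_ofFn, SemistandardYoungTableau.rowContent,
    Finset.sum_range]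
  rfl

theorem exists_tab_eq_rowsProd {L : List (List (Fin n) × (ℕ →₀ ℕ))}
    (hrow : ∀ r ∈ L, IsStandardRow r) (hchain : L.IsChain IsStandardPair) :
    ∃ (μ : YoungDiagram) (T : RowStrictTableau μ (Fin n)) (S : SemistandardYoungTableau μ),
      tab T S = rowsProd L := by
  have : IsTrans _ (IsStandardPair (n := n)) := ⟨fun _ _ _ h h' => h.trans h'⟩
  have hpw : L.Pairwise IsStandardPair := List.isChain_iff_pairwise.mp hchain
  have hpair : ∀ (i i' : ℕ) (h : i < L.length) (h' : i' < L.length), i < i' →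
      IsStandardPair L[i] L[i'] := fun i i' h h' hlt =>
    List.pairwise_iff_getElem.mp hpw i i' h h' hlt
  have hlens : (L.map fun r => r.1.length).SortedGE := by
    rw [List.sortedGE_iff_pairwise, List.pairwise_map]
    exact hpw.imp fun h => h.1
  set μ := YoungDiagram.ofRowLens (L.map fun r => r.1.length) hlens with hμ
  have hmem : ∀ {i j : ℕ}, (i, j) ∈ μ ↔ ∃ h : i < L.length, j < L[i].1.length := by
    intro i j
    rw [hμ, YoungDiagram.mem_ofRowLens]
    simp
  have hrowLen : ∀ (i : ℕ) (h : i < L.length), μ.rowLen i = L[i].1.length := by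
    intro i h
    apply le_antisymm
    · by_contra! hcon
      exact lt_irrefl _ (hmem.mp (YoungDiagram.mem_iff_lt_rowLen.mpr hcon)).2
    · by_contra! hcon
      exact lt_irrefl _ (YoungDiagram.mem_iff_lt_rowLen.mp (hmem.mpr ⟨h, hcon⟩))
  have hcolLen : μ.colLen 0 = L.length := by
    apply le_antisymm
    · by_contra! hcon
      exact lt_irrefl _ (hmem.mp (YoungDiagram.mem_iff_lt_colLen.mpr hcon)).1
    · by_contra! hcon
      -- Rows are nonempty, so each of them meets column 0 and is counted by `μ.colLen 0`.
      have h0 : 0 < L[μ.colLen 0].1.length :=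
        List.length_pos_iff.mpr (hrow _ (List.getElem_mem hcon)).2.2
      exact lt_irrefl _ (YoungDiagram.mem_iff_lt_colLen.mp (hmem.mpr ⟨hcon, h0⟩))
  have hplen : ∀ (i : ℕ) (h : i < L.length), (places L[i].2).length = L[i].1.length := by
    intro i h
    rw [length_places, (hrow _ (List.getElem_mem h)).2.1]
  let T : RowStrictTableau μ (Fin n) :=
    { entry := fun c => (L[c.1.1]'(hmem.mp c.2).1).1[c.1.2]'(hmem.mp c.2).2
      row_strict := by
        intro i j j' h h' hlt
        exact List.pairwise_iff_getElem.mp (hrow _ (List.getElem_mem (hmem.mp h).1)).1 _ _ _ _ hlt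
      col_weak := by
        intro i i' j h h' hlt
        exact (hpair i i' (hmem.mp h).1 (hmem.mp h').1 hlt).getElem_word_le
          (hrow _ (List.getElem_mem _)) (hrow _ (List.getElem_mem _)) j _ _ }
  have lt_places : ∀ {i j : ℕ} (h : (i, j) ∈ μ), j < (places (L[i]'(hmem.mp h).1).2).length := by
    intro i j h
    rw [hplen]
    exact (hmem.mp h).2
  let S : SemistandardYoungTableau μ :=
    { entry := fun i j => if h : (i, j) ∈ μ then
        (places (L[i]'(hmem.mp h).1).2)[j]'(lt_places h) else 0
      row_weak' := by
        intro i j j' hlt h'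
        have h : (i, j) ∈ μ := μ.up_left_mem le_rfl hlt.le h'
        rw [dif_pos h, dif_pos h']
        exact List.pairwise_iff_getElem.mp (pairwise_places _) _ _ _ _ hlt
      col_strict' := by
        intro i i' j hlt h'
        have h : (i, j) ∈ μ := μ.up_left_mem hlt.le le_rfl h'
        rw [dif_pos h, dif_pos h']
        exact (hpair i i' (hmem.mp h).1 (hmem.mp h').1 hlt).getElem_places_lt j _ _
      zeros' := by
        intro i j h
        rw [dif_neg h] }
  refine ⟨μ, T, S, ?_⟩
  unfold tab rowsProd
  congr 1
  refine List.ext_getElem (by simp [hcolLen]) fun i h1 h2 => ?_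
  have hi : i < L.length := by simpa using h2
  rw [List.getElem_ofFn, List.getElem_map, bracket]
  have hw : T.rowWord i = L[i].1 := by
    refine List.ext_getElem (by simp [RowStrictTableau.rowWord, hrowLen i hi]) fun j h3 h4 => ?_
    simp [RowStrictTableau.rowWord, T]
  have hc : S.rowContent i = L[i].2 := by
    conv_rhs => rw [← content_places L[i].2]
    rw [rowContent_eq_content]
    congr 1
    refine List.ext_getElem (by simp [hrowLen i hi, hplen i hi]) fun j h3 h4 => ?_
    have hij : (i, j) ∈ μ := hmem.mpr ⟨hi, by rw [← hplen i hi]; exact h4⟩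
    rw [List.getElem_ofFn]
    exact dif_pos hij
  rw [hw, hc]

end

end LetterPlaceAlgebra

namespace LetterPlaceAlgebra

noncomputable section

/-! ### Rearrangement inequalities for lists -/

theorem sum_range_card_le_sum (s : Finset ℕ) : ∑ i ∈ Finset.range s.card, i ≤ ∑ i ∈ s, i := by
  induction s using Finset.induction_on_max with
  | empty => simp
  | insert a s ha ih =>
    have hnot : a ∉ s := fun h => lt_irrefl _ (ha a h)
    have hcard : s.card ≤ a := by
      have : s ⊆ Finset.range a := fun x hx => Finset.mem_range.mpr (ha x hx)
      simpa using Finset.card_le_card this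
    rw [Finset.card_insert_of_notMem hnot, Finset.sum_range_succ, Finset.sum_insert hnot]
    omega

theorem sum_range_le_sum_of_nodup {c : List ℕ} (hc : c.Nodup) :
    (List.range c.length).sum ≤ c.sum := by
  have h := sum_range_card_le_sum c.toFinset
  rw [List.toFinset_card_of_nodup hc] at h
  have h1 : ∑ i ∈ c.toFinset, i = c.sum := by
    simpa using List.sum_toFinset (fun i : ℕ => i) hc
  have h2 : ∑ i ∈ Finset.range c.length, i = (List.range c.length).sum := by
    rw [← List.toFinset_range]
    simpa using List.sum_toFinset (fun i : ℕ => i) (List.nodup_range (n := c.length))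
  omega

theorem sum_zipWith_mul_map_sub {c d : List ℕ} (hlen : c.length = d.length) {δ : ℕ}
    (hδ : ∀ x ∈ d, δ ≤ x) : (List.zipWith (· * ·) c d).sum =
      (List.zipWith (· * ·) c (d.map (· - δ))).sum + δ * c.sum := by
  induction c generalizing d with
  | nil => simp
  | cons a c ih =>
    cases d with
    | nil => simp at hlen
    | cons b d =>
      simp only [List.zipWith_cons_cons, List.sum_cons, List.map_cons]
      rw [ih (by simpa using hlen) fun x hx => hδ x (by simp [hx])]
      have hb : δ ≤ b := hδ b (by simp)
      obtain ⟨e, rfl⟩ := Nat.exists_eq_add_of_le hb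
      rw [Nat.add_sub_cancel_left]
      ring

/-- Strict rearrangement: decreasing weights favour the smallest distinct values in increasing
order. This singles out the coordinates `0, 1, 2, …` along a row. -/
theorem sum_zipWith_range_lt (k : ℕ) : ∀ {c d : List ℕ}, d.length = k → c.length = k →
    c.Nodup → d.Pairwise (· > ·) → (∀ x ∈ d, 0 < x) → c ≠ List.range k →
    (List.zipWith (· * ·) (List.range k) d).sum < (List.zipWith (· * ·) c d).sum := by
  induction k with
  | zero =>
    intro c d _ hc _ _ _ hne
    rw [List.length_eq_zero_iff] at hc
    simp [hc] at hne
  | succ k ih =>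
    intro c d hd hc hnd hdec hpos hne
    obtain ⟨d', δ, rfl⟩ : ∃ d' δ, d = d' ++ [δ] := by
      rcases List.eq_nil_or_concat d with rfl | ⟨d', δ, h⟩
      · simp at hd
      · exact ⟨d', δ, by simpa using h⟩
    obtain ⟨c', γ, rfl⟩ : ∃ c' γ, c = c' ++ [γ] := by
      rcases List.eq_nil_or_concat c with rfl | ⟨c', γ, h⟩
      · simp at hc
      · exact ⟨c', γ, by simpa using h⟩
    simp only [List.length_append, List.length_singleton, Nat.add_right_cancel_iff] at hd hc
    rw [List.pairwise_append] at hdec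
    have hδ : ∀ x ∈ d', δ < x := fun x hx => hdec.2.2 x hx δ (by simp)
    have hδpos : 0 < δ := hpos δ (by simp)
    have hsum := sum_range_le_sum_of_nodup hnd
    rw [List.length_append, List.length_singleton, hc] at hsum
    -- Abel summation: the smallest weight `δ` is split off from all weights. It multiplies the full
    -- sum of `c`, and the reduced weights `d' - δ` are again decreasing and positive.
    rw [List.range_succ, List.zipWith_append (by simp [hd]), List.zipWith_append (by simp [hd, hc]),
      List.sum_append, List.sum_append,
      sum_zipWith_mul_map_sub (by simp [hd]) (fun x hx => (hδ x hx).le),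
      sum_zipWith_mul_map_sub (by simp [hd, hc]) (fun x hx => (hδ x hx).le)]
    simp only [List.zipWith_cons_cons, List.zipWith_nil_left, List.sum_cons, List.sum_nil, add_zero]
    rw [List.range_succ] at hsum hne
    simp only [List.sum_append, List.sum_cons, List.sum_nil, add_zero] at hsum
    have hnd' : c'.Nodup := (List.nodup_append.mp hnd).1
    by_cases hc' : c' = List.range k
    · subst hc'
      have hγ : k < γ := by
        have h1 : γ ∉ List.range k := fun h =>
          (List.nodup_append.mp hnd).2.2 γ h γ (by simp) rfl
        have h2 : γ ≠ k := by rintro rfl; exact hne rfl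
        rw [List.mem_range] at h1
        omega
      have := Nat.mul_lt_mul_of_pos_right hγ hδpos
      omega
    · have h1 := ih (c := c') (d := d'.map (· - δ)) (by simpa using hd) hc hnd' ?_ ?_ hc'
      · nlinarith
      · rw [List.pairwise_map]
        refine hdec.1.imp_of_mem fun {a b} ha hb hab => ?_
        have := hδ a ha
        have := hδ b hb
        omega
      · intro x hx
        obtain ⟨y, hy, rfl⟩ := List.mem_map.mp hx
        have := hδ y hy
        omega

/-- The sum `m u₀ + (m + 1) u₁ + (m + 2) u₂ + ⋯`. -/
def posSum : ℕ → List ℕ → ℕ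
  | _, [] => 0
  | m, x :: u => m * x + posSum (m + 1) u

theorem posSum_swap_lt (m : ℕ) (A B : List ℕ) {x y : ℕ} (h : y < x) :
    posSum m (A ++ x :: y :: B) < posSum m (A ++ y :: x :: B) := by
  induction A generalizing m with
  | nil =>
    simp only [List.nil_append, posSum]
    nlinarith
  | cons a A ih =>
    simp only [List.cons_append, posSum]
    have := ih (m + 1)
    omega

/-- A maximal arrangement has no adjacent descent, since swapping one would increase the sum; hence
the sorted arrangement is the only maximum. -/
theorem posSum_lt_of_perm (m : ℕ) {u p : List ℕ} (hp : p.Pairwise (· ≤ ·)) (h : u.Perm p)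
    (hne : u ≠ p) : posSum m u < posSum m p := by
  have hmax : ∀ v : List ℕ, v.Perm p → (∀ v', v'.Perm p → posSum m v' ≤ posSum m v) → v = p := by
    intro v hv hle
    by_contra hvp
    have hns : ¬v.IsChain (· ≤ ·) := fun hs =>
      hvp (hv.eq_of_pairwise' (List.isChain_iff_pairwise.mp hs) hp)
    obtain ⟨A, B, x, y, rfl, hxy⟩ := exists_not_of_not_isChain hns
    have h1 := posSum_swap_lt m A B (not_le.mp hxy)
    have h2 := hle (A ++ y :: x :: B) (((List.Perm.swap x y B).append_left A).trans hv)
    omega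
  obtain ⟨v, hv, hvmax⟩ := p.permutations.toFinset.exists_max_image (posSum m)
    ⟨p, by simp⟩
  simp only [List.mem_toFinset, List.mem_permutations] at hv hvmax
  obtain rfl := hmax v hv hvmax
  refine lt_of_le_of_ne (hvmax u h) fun heq => hne (hmax u h fun v' hperm => ?_)
  rw [heq]
  exact hvmax v' hperm

/-! ### Finite sets of lists -/

/-- The lists whose entries are chosen from the members of a list of finite sets. -/
def choices : List (Finset ℕ) → Finset (List ℕ)
  | [] => {[]}
  | s :: L => (s ×ˢ choices L).map
      ⟨fun p => p.1 :: p.2, fun p q h => by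
        rw [List.cons.injEq] at h
        exact Prod.ext h.1 h.2⟩

theorem mem_choices {L : List (Finset ℕ)} {c : List ℕ} :
    c ∈ choices L ↔ List.Forall₂ (· ∈ ·) c L := by
  induction L generalizing c with
  | nil => simp [choices]
  | cons s L ih =>
    cases c with
    | nil => simp [choices]
    | cons a c =>
      rw [List.forall₂_cons, ← ih, choices, Finset.mem_map]
      constructor
      · rintro ⟨⟨b, d⟩, hp, h⟩
        obtain ⟨rfl, rfl⟩ := List.cons.inj h
        exact Finset.mem_product.mp hp
      · exact fun h => ⟨(a, c), Finset.mem_product.mpr h, rfl⟩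

theorem sum_choices_cons {M : Type*} [AddCommMonoid M] (s : Finset ℕ) (L : List (Finset ℕ))
    (f : List ℕ → M) : ∑ c ∈ choices (s :: L), f c = ∑ a ∈ s, ∑ c ∈ choices L, f (a :: c) := by
  rw [choices, Finset.sum_map, Finset.sum_product]
  rfl

theorem length_of_mem_choices {L : List (Finset ℕ)} {c : List ℕ} (h : c ∈ choices L) :
    c.length = L.length := (mem_choices.mp h).length_eq

/-- Iterated `bracket_cons`. The index set `s` may exceed the support, so that it can stay fixed
while places are removed from `α`. -/
theorem bracket_eq_sum_choices {E : Type*} {s : Finset ℕ} (w : List E) {α : ℕ →₀ ℕ}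
    (hs : α.support ⊆ s) : bracket w α = ∑ u ∈ choices (w.map fun _ => s),
      if content u = α then (List.zipWith pair w u).prod else 0 := by
  induction w generalizing α with
  | nil =>
    rw [bracket_nil, List.map_nil, choices, Finset.sum_singleton]
    simp [content, eq_comm]
  | cons e w ih =>
    rw [bracket_cons, List.map_cons, sum_choices_cons]
    refine Finset.sum_subset_zero_on_sdiff hs ?_ ?_
    · intro j hj
      refine Finset.sum_eq_zero fun u _ => if_neg ?_
      rw [Finset.mem_sdiff, Finsupp.mem_support_iff, not_not] at hj
      intro h
      have := DFunLike.congr_fun h j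
      rw [content_cons, Finsupp.add_apply, Finsupp.single_eq_same, hj.2] at this
      omega
    · intro j hj
      have hle : Finsupp.single j 1 ≤ α := by
        rw [Finsupp.single_le_iff]
        exact Nat.one_le_iff_ne_zero.mpr (Finsupp.mem_support_iff.mp hj)
      rw [ih (Finsupp.support_tsub.trans hs), Finset.mul_sum]
      refine Finset.sum_congr rfl fun u _ => ?_
      rw [content_cons, mul_ite, mul_zero, List.zipWith_cons_cons, List.prod_cons]
      refine if_congr ?_ rfl rfl
      rw [eq_tsub_iff_add_eq_of_le hle, add_comm]

end

end LetterPlaceAlgebra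

namespace LetterPlaceAlgebra

noncomputable section

variable {n : ℕ}

/-! ### The generic representation -/

/-- The exterior algebra on symbols `(c|p_k)`, `c, k ∈ ℕ`, over the ring of integer polynomials in
variables `X (e, c)`. -/
abbrev GenericAlgebra (n : ℕ) : Type :=
  ExteriorAlgebra (MvPolynomial (Fin n × ℕ) ℤ) (ℕ × ℕ →₀ MvPolynomial (Fin n × ℕ) ℤ)

/-- The generator `(c|p_k)`. -/
def genericPair (n : ℕ) (q : ℕ × ℕ) : GenericAlgebra n :=
  ExteriorAlgebra.ι (MvPolynomial (Fin n × ℕ) ℤ) (Finsupp.single q 1)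

/-- The element `X (e, c) (c|p_k)`. -/
def genericCell (t : Fin n × ℕ × ℕ) : GenericAlgebra n :=
  (MvPolynomial.X (t.1, t.2.1) : MvPolynomial (Fin n × ℕ) ℤ) • genericPair n t.2

/-- The homomorphism of exterior algebras defined by an additive map to the free module. -/
def genericLift {E : Type*} (f : E × ℕ → ℕ × ℕ →₀ MvPolynomial (Fin n × ℕ) ℤ) :
    LetterPlaceAlgebra E →ₐ[ℤ] GenericAlgebra n :=
  ExteriorAlgebra.lift ℤ
    ⟨(ExteriorAlgebra.ι (MvPolynomial (Fin n × ℕ) ℤ)).restrictScalars ℤ ∘ₗ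
      Finsupp.linearCombination ℤ f, fun _ => ExteriorAlgebra.ι_sq_zero _⟩

theorem genericLift_pair {E : Type*} (f : E × ℕ → ℕ × ℕ →₀ MvPolynomial (Fin n × ℕ) ℤ)
    (e : E) (k : ℕ) :
    genericLift f (pair e k) = ExteriorAlgebra.ι (MvPolynomial (Fin n × ℕ) ℤ) (f (e, k)) := by
  refine (ExteriorAlgebra.lift_ι_apply ℤ _ _ _).trans ?_
  change ExteriorAlgebra.ι _ (Finsupp.linearCombination ℤ f (Finsupp.single (e, k) 1)) = _
  rw [Finsupp.linearCombination_single, one_smul]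

/-- The homomorphism with `(c|p_k) ↦ (c|p_k)`. -/
def baseChange (n : ℕ) : LetterPlaceAlgebra ℕ →ₐ[ℤ] GenericAlgebra n :=
  genericLift fun q => Finsupp.single q 1

theorem baseChange_pair (c k : ℕ) : baseChange n (pair c k) = genericPair n (c, k) :=
  genericLift_pair _ _ _

/-- The homomorphism with `(e|p_k) ↦ ∑_{c < h e} X (e, c) (c|p_k)`. -/
def genericRep (h : Fin n → ℕ) : LetterPlaceAlgebra (Fin n) →ₐ[ℤ] GenericAlgebra n :=
  genericLift fun p => ∑ c ∈ Finset.range (h p.1), Finsupp.single (c, p.2) (MvPolynomial.X (p.1, c))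

theorem genericRep_pair (h : Fin n → ℕ) (e : Fin n) (k : ℕ) :
    genericRep h (pair e k) = ∑ c ∈ Finset.range (h e), genericCell (e, c, k) := by
  rw [genericRep, genericLift_pair, map_sum]
  refine Finset.sum_congr rfl fun c _ => ?_
  rw [genericCell, genericPair, ← map_smul, Finsupp.smul_single, smul_eq_mul, mul_one]

/-- The product of the elements `X (e, c) (c|p_k)` over a list of triples `(e, c, k)`. -/
def cellProd (l : List (Fin n × ℕ × ℕ)) : GenericAlgebra n := (l.map genericCell).prod

theorem cellProd_append (l l' : List (Fin n × ℕ × ℕ)) :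
    cellProd (l ++ l') = cellProd l * cellProd l' := by simp [cellProd]

/-- The product of the variables `X (e, c)` over a list of triples `(e, c, k)`. -/
def varProd (l : List (Fin n × ℕ × ℕ)) : MvPolynomial (Fin n × ℕ) ℤ :=
  (l.map fun t => MvPolynomial.X (t.1, t.2.1)).prod

theorem cellProd_eq_smul (l : List (Fin n × ℕ × ℕ)) :
    cellProd l = varProd l • (l.map fun t => genericPair n t.2).prod := by
  induction l with
  | nil => simp [cellProd, varProd]
  | cons t l ih =>
    simp only [cellProd, varProd, List.map_cons, List.prod_cons] at ih ⊢
    rw [ih, genericCell, smul_mul_smul_comm]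

theorem prod_zipWith_genericRep (h : Fin n → ℕ) {w : List (Fin n)} {u : List ℕ}
    (hlen : u.length = w.length) :
    (List.zipWith (fun e k => genericRep h (pair e k)) w u).prod =
      ∑ c ∈ choices (w.map fun e => Finset.range (h e)), cellProd (w.zip (c.zip u)) := by
  induction w generalizing u with
  | nil => simp [choices, cellProd]
  | cons e w ih =>
    cases u with
    | nil => simp at hlen
    | cons k u =>
      rw [List.zipWith_cons_cons, List.prod_cons, ih (by simpa using hlen), genericRep_pair,
        List.map_cons, sum_choices_cons, Finset.sum_mul_sum]
      simp [cellProd]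

theorem prod_genericPair_eq_baseChange {w : List (Fin n)} {c u : List ℕ}
    (hw : w.length = c.length) (hu : u.length = c.length) :
    ((w.zip (c.zip u)).map fun t => genericPair n t.2).prod =
      baseChange n (List.zipWith pair c u).prod := by
  induction c generalizing w u with
  | nil => simp
  | cons a c ih =>
    cases w with
    | nil => simp at hw
    | cons e w =>
      cases u with
      | nil => simp at hu
      | cons k u =>
        simp only [List.zip_cons_cons, List.map_cons, List.prod_cons, List.zipWith_cons_cons,
          map_mul, baseChange_pair]
        rw [ih (by simpa using hw) (by simpa using hu)]

theorem varProd_zip {w : List (Fin n)} {c u : List ℕ} (hu : u.length = c.length) :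
    varProd (w.zip (c.zip u)) = (List.zipWith (fun e a => MvPolynomial.X (e, a)) w c).prod := by
  induction c generalizing w u with
  | nil => simp [varProd]
  | cons a c ih =>
    cases w with
    | nil => simp [varProd]
    | cons e w =>
      cases u with
      | nil => simp at hu
      | cons k u =>
        have := ih (w := w) (u := u) (by simpa using hu)
        simp only [varProd] at this
        simp [varProd, this]

/-- The expansion of a bracket in the generic representation. -/
theorem genericRep_bracket (h : Fin n → ℕ) (w : List (Fin n)) (α : ℕ →₀ ℕ) :
    genericRep h (bracket w α) =
      ∑ c ∈ choices (w.map fun e => Finset.range (h e)) with c.Nodup,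
        ∑ u ∈ choices (w.map fun _ => α.support) with content u = α,
          cellProd (w.zip (c.zip u)) := by
  rw [bracket_eq_sum_choices w subset_rfl, map_sum, Finset.sum_filter]
  have h1 : ∀ u ∈ choices (w.map fun _ => α.support),
      genericRep h (if content u = α then (List.zipWith pair w u).prod else 0) =
        ∑ c ∈ choices (w.map fun e => Finset.range (h e)),
          if content u = α then cellProd (w.zip (c.zip u)) else 0 := by
    intro u hu
    have hlen : u.length = w.length := by simpa using length_of_mem_choices hu
    split_ifs
    · rw [map_list_prod, List.map_zipWith, prod_zipWith_genericRep h hlen]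
    · simp
  rw [Finset.sum_congr rfl h1, Finset.sum_comm]
  refine Finset.sum_congr rfl fun c hc => ?_
  have hcw : c.length = w.length := by simpa using length_of_mem_choices hc
  rw [Finset.sum_filter]
  split_ifs with hnd
  · rfl
  -- For a fixed coordinate list `c`, the inner sum is a monomial times the image of the bracket of
  -- the word `c`, which vanishes when `c` repeats a coordinate.
  · have h2 := bracket_of_not_nodup hnd α
    rw [bracket_eq_sum_choices c subset_rfl] at h2
    have h3 := congrArg (fun z => (List.zipWith
      (fun e a => (MvPolynomial.X (e, a) : MvPolynomial (Fin n × ℕ) ℤ)) w c).prod •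
      baseChange n z) h2
    simp only [map_zero, smul_zero, map_sum, Finset.smul_sum] at h3
    have h4 : (c.map fun _ => α.support) = w.map fun _ => α.support := by
      rw [List.map_const', List.map_const', hcw]
    rw [h4] at h3
    refine Eq.trans ?_ h3
    refine Finset.sum_congr rfl fun u hu => ?_
    have hlen : u.length = c.length := by rw [hcw]; simpa using length_of_mem_choices hu
    split_ifs
    · rw [cellProd_eq_smul, varProd_zip hlen, prod_genericPair_eq_baseChange hcw.symm hlen]
    · simp

/-- Words with too many small letters vanish in the generic representation. -/
theorem genericRep_bracket_eq_zero {h : Fin n → ℕ} (hmono : Monotone h) {w : List (Fin n)}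
    (i : Fin n) (hi : h i < (w.filter (· ≤ i)).length) (α : ℕ →₀ ℕ) :
    genericRep h (bracket w α) = 0 := by
  rw [genericRep_bracket]
  refine Finset.sum_eq_zero fun c hc => ?_
  exfalso
  rw [Finset.mem_filter, mem_choices] at hc
  obtain ⟨hc, hnd⟩ := hc
  -- The letters at most `i` choose coordinates below `h i`, by monotonicity. These would be
  -- distinct and more than `h i` in number.
  have key : ∀ {w : List (Fin n)} {c : List ℕ},
      List.Forall₂ (· ∈ ·) c (w.map fun e => Finset.range (h e)) →
      ∃ d : List ℕ, d.Sublist c ∧ d.length = (w.filter (· ≤ i)).length ∧ ∀ x ∈ d, x < h i := by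
    intro w
    induction w with
    | nil => intro c _; exact ⟨[], List.nil_sublist _, rfl, by simp⟩
    | cons e w ih =>
      intro c hc
      rw [List.map_cons] at hc
      cases hc with
      | @cons a _ c' _ ha hc' =>
        obtain ⟨d, hd, hlen, hlt⟩ := ih hc'
        by_cases he : e ≤ i
        · refine ⟨a :: d, hd.cons_cons a, ?_, ?_⟩
          · rw [List.filter_cons_of_pos (by simpa using he), List.length_cons, List.length_cons,
              hlen]
          · intro x hx
            rcases List.mem_cons.mp hx with rfl | hx
            · exact (Finset.mem_range.mp ha).trans_le (hmono he)
            · exact hlt x hx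
        · exact ⟨d, hd.cons a, by rw [List.filter_cons_of_neg (by simpa using he), hlen], hlt⟩
  obtain ⟨d, hd, hlen, hlt⟩ := key hc
  have hdn : d.Nodup := hnd.sublist hd
  have : d.toFinset ⊆ Finset.range (h i) := fun x hx =>
    Finset.mem_range.mpr (hlt x (List.mem_toFinset.mp hx))
  have := Finset.card_le_card this
  rw [List.toFinset_card_of_nodup hdn, Finset.card_range] at this
  omega

/-! ### Leading terms -/

/-- The weight of a list of triples `(e, c, k)`. -/
def cellWeight (l : List (Fin n × ℕ × ℕ)) : ℤ ×ₗ ℤ :=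
  toLex ((l.map fun t => (t.2.1 : ℤ) * (n - (t.1.val : ℤ))).sum,
    -(l.map fun t => (t.2.1 : ℤ) * t.2.2).sum)

theorem cellWeight_append (l l' : List (Fin n × ℕ × ℕ)) :
    cellWeight (l ++ l') = cellWeight l + cellWeight l' := by
  simp only [cellWeight, List.map_append, List.sum_append, neg_add]
  rfl

/-- The first weight component depends on the pairs `(e, c)` and the second on the pairs `(c, k)`,
exactly the data seen by the functionals of `exists_coefficient`. -/
theorem cellWeight_eq_of_perm {l l' : List (Fin n × ℕ × ℕ)}
    (h : (l.map fun t => (t.1, t.2.1)).Perm (l'.map fun t => (t.1, t.2.1)))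
    (h' : (l.map Prod.snd).Perm (l'.map Prod.snd)) : cellWeight l = cellWeight l' := by
  have h1 := (h.map fun p => (p.2 : ℤ) * (n - (p.1.val : ℤ))).sum_eq
  have h2 := (h'.map fun p => (p.1 : ℤ) * (p.2 : ℤ)).sum_eq
  rw [List.map_map, List.map_map] at h1 h2
  simp only [cellWeight]
  congr 2
  exact congrArg Neg.neg h2

/-- The additive group generated by the products of cells of weight greater than `a`. -/
def higher (n : ℕ) (a : ℤ ×ₗ ℤ) : AddSubgroup (GenericAlgebra n) :=
  AddSubgroup.closure {z | ∃ l : List (Fin n × ℕ × ℕ), a < cellWeight l ∧ z = cellProd l}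

theorem mul_cellProd_mem_higher {a : ℤ ×ₗ ℤ} {x : GenericAlgebra n} (hx : x ∈ higher n a)
    (l' : List (Fin n × ℕ × ℕ)) : x * cellProd l' ∈ higher n (a + cellWeight l') := by
  refine (?_ : higher n a ≤ (higher n (a + cellWeight l')).comap
    (AddMonoidHom.mulRight (cellProd l'))) hx
  refine (AddSubgroup.closure_le _).mpr ?_
  rintro _ ⟨l, hl, rfl⟩
  refine AddSubgroup.subset_closure ⟨l ++ l', ?_, (cellProd_append l l').symm⟩
  rw [cellWeight_append]
  exact add_lt_add_left hl _

theorem cellProd_mul_mem_higher {a : ℤ ×ₗ ℤ} {x : GenericAlgebra n} (hx : x ∈ higher n a)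
    (l' : List (Fin n × ℕ × ℕ)) : cellProd l' * x ∈ higher n (cellWeight l' + a) := by
  refine (?_ : higher n a ≤ (higher n (cellWeight l' + a)).comap
    (AddMonoidHom.mulLeft (cellProd l'))) hx
  refine (AddSubgroup.closure_le _).mpr ?_
  rintro _ ⟨l, hl, rfl⟩
  refine AddSubgroup.subset_closure ⟨l' ++ l, ?_, (cellProd_append l' l).symm⟩
  rw [cellWeight_append]
  exact add_lt_add_right hl _

theorem higher_anti {a b : ℤ ×ₗ ℤ} (h : a ≤ b) : higher n b ≤ higher n a :=
  AddSubgroup.closure_mono fun _ ⟨l, hl, hz⟩ => ⟨l, h.trans_lt hl, hz⟩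

theorem mul_mem_higher {a b : ℤ ×ₗ ℤ} {x y : GenericAlgebra n} (hx : x ∈ higher n a)
    (hy : y ∈ higher n b) : x * y ∈ higher n (a + b) := by
  refine (?_ : higher n b ≤ (higher n (a + b)).comap (AddMonoidHom.mulLeft x)) hy
  refine (AddSubgroup.closure_le _).mpr ?_
  rintro _ ⟨l, hl, rfl⟩
  exact higher_anti (by gcongr) (mul_cellProd_mem_higher hx l)

/-- The element `x` is the product of the cells in `l` plus terms of greater weight. -/
def HasLead (x : GenericAlgebra n) (l : List (Fin n × ℕ × ℕ)) : Prop :=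
  x - cellProd l ∈ higher n (cellWeight l)

theorem HasLead.one : HasLead (1 : GenericAlgebra n) [] := by
  simp [HasLead, cellProd]

theorem HasLead.mul {x y : GenericAlgebra n} {l l' : List (Fin n × ℕ × ℕ)} (hx : HasLead x l)
    (hy : HasLead y l') : HasLead (x * y) (l ++ l') := by
  unfold HasLead at hx hy ⊢
  have h : x * y - cellProd (l ++ l') = (x - cellProd l) * (y - cellProd l') +
      (x - cellProd l) * cellProd l' + cellProd l * (y - cellProd l') := by
    rw [cellProd_append]
    noncomm_ring
  rw [h, cellWeight_append]
  exact add_mem (add_mem (mul_mem_higher hx hy)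
    (mul_cellProd_mem_higher hx l')) (cellProd_mul_mem_higher hy l)

end

end LetterPlaceAlgebra

namespace LetterPlaceAlgebra

noncomputable section

variable {n : ℕ}

theorem sum_map_zip_letters {w : List (Fin n)} {c u : List ℕ} (hc : c.length = w.length)
    (hu : u.length = w.length) :
    ((w.zip (c.zip u)).map fun t => (t.2.1 : ℤ) * (n - (t.1.val : ℤ))).sum =
      ((List.zipWith (· * ·) c (w.map fun e => n - e.val)).sum : ℕ) := by
  induction w generalizing c u with
  | nil => simp
  | cons e w ih =>
    cases c with
    | nil => simp at hc
    | cons a c =>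
      cases u with
      | nil => simp at hu
      | cons k u =>
        have := ih (c := c) (u := u) (by simpa using hc) (by simpa using hu)
        simp only [List.zip_cons_cons, List.map_cons, List.sum_cons, List.zipWith_cons_cons, this]
        rw [Nat.cast_add, Nat.cast_mul, Nat.cast_sub e.isLt.le]

theorem sum_map_zip_places {w : List (Fin n)} {u : List ℕ} (m : ℕ) (hu : u.length = w.length) :
    ((w.zip ((List.range' m w.length).zip u)).map fun t => (t.2.1 : ℤ) * t.2.2).sum =
      (posSum m u : ℤ) := by
  induction w generalizing u m with
  | nil =>
    rw [List.length_nil, List.length_eq_zero_iff] at hu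
    simp [hu, posSum]
  | cons e w ih =>
    cases u with
    | nil => simp at hu
    | cons k u =>
      rw [List.length_cons, List.range'_succ]
      simp only [List.zip_cons_cons, List.map_cons, List.sum_cons, posSum]
      rw [ih (m + 1) (by simpa using hu)]
      push_cast
      ring

/-- The leading term of a bracket in the generic representation. -/
theorem hasLead_bracket (h : Fin n → ℕ) {w : List (Fin n)} (hw : w.Pairwise (· < ·))
    (hind : ∀ (j : ℕ) (hj : j < w.length), j < h w[j]) {p : List ℕ} (hp : p.Pairwise (· ≤ ·))
    (hlen : p.length = w.length) :
    HasLead (genericRep h (bracket w (content p))) (w.zip ((List.range w.length).zip p)) := by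
  unfold HasLead
  rw [genericRep_bracket, ← Finset.sum_product']
  have hmem : (List.range w.length, p) ∈
      ({c ∈ choices (w.map fun e => Finset.range (h e)) | c.Nodup} : Finset _) ×ˢ
      ({u ∈ choices (w.map fun _ => (content p).support) | content u = content p} : Finset _) := by
    rw [Finset.mem_product, Finset.mem_filter, Finset.mem_filter]
    refine ⟨⟨mem_choices.mpr ?_, List.nodup_range⟩, mem_choices.mpr ?_, rfl⟩
    · rw [List.forall₂_iff_get]
      refine ⟨by simp, fun i h1 h2 => ?_⟩
      simpa using hind i (by simpa using h1)
    · rw [List.forall₂_iff_get]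
      refine ⟨by simpa using hlen, fun i h1 h2 => ?_⟩
      simp [content_eq_toFinsupp]
  rw [← Finset.add_sum_erase _ _ hmem, add_sub_cancel_left]
  refine sum_mem fun x hx => AddSubgroup.subset_closure ⟨_, ?_, rfl⟩
  obtain ⟨c, u⟩ := x
  rw [Finset.mem_erase, Finset.mem_product, Finset.mem_filter, Finset.mem_filter] at hx
  obtain ⟨hne, ⟨hc, hnd⟩, hu, hcont⟩ := hx
  have hcl : c.length = w.length := by simpa using length_of_mem_choices hc
  have hul : u.length = w.length := by simpa using length_of_mem_choices hu
  have hperm : u.Perm p := content_eq_content_iff.mp hcont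
  simp only [cellWeight]
  rw [Prod.Lex.toLex_lt_toLex, sum_map_zip_letters (by simp) hlen, sum_map_zip_letters hcl hul]
  -- The first weight component is strictly larger unless the coordinates are `0, 1, 2, …`. In that
  -- case only the places can differ, and the second component decides.
  by_cases hcr : c = List.range w.length
  · right
    have hup : u ≠ p := by
      rintro rfl
      exact hne (by rw [hcr])
    refine ⟨by rw [hcr], ?_⟩
    simp only [hcr, List.range_eq_range']
    rw [sum_map_zip_places 0 hlen, sum_map_zip_places 0 hul]
    have := posSum_lt_of_perm 0 hp hperm hup
    omega
  · left
    refine Nat.cast_lt.mpr (sum_zipWith_range_lt w.length (by simp) hcl hnd ?_ ?_ hcr)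
    · rw [List.pairwise_map]
      refine hw.imp fun {a b} hab => ?_
      rw [Fin.lt_def] at hab
      omega
    · intro x hx
      obtain ⟨e, _, rfl⟩ := List.mem_map.mp hx
      omega

/-! ### Coefficients in the generic algebra -/

/-- The coefficient of the exterior monomial with factors `K 0, …, K (k - 1)`. -/
def coordDet {k : ℕ} (K : Fin k → ℕ × ℕ) :
    GenericAlgebra n →ₗ[MvPolynomial (Fin n × ℕ) ℤ] MvPolynomial (Fin n × ℕ) ℤ :=
  ExteriorAlgebra.liftAlternating
    (Pi.single (M := fun i => (ℕ × ℕ →₀ MvPolynomial (Fin n × ℕ) ℤ)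
        [⋀^Fin i]→ₗ[MvPolynomial (Fin n × ℕ) ℤ] MvPolynomial (Fin n × ℕ) ℤ) k
      (Matrix.detRowAlternating.compLinearMap
        (LinearMap.pi fun j => Finsupp.lapply (K j))))

theorem prod_genericPair_eq_ιMulti (p : List (ℕ × ℕ)) :
    (p.map (genericPair n)).prod = ExteriorAlgebra.ιMulti (MvPolynomial (Fin n × ℕ) ℤ) p.length
      fun i => Finsupp.single (p.get i) 1 := by
  rw [ExteriorAlgebra.ιMulti_apply]
  congr 1
  refine List.ext_getElem (by simp) fun i h1 h2 => ?_
  simp [genericPair]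

theorem coordDet_self (p : List (ℕ × ℕ)) (hp : p.Nodup) :
    coordDet p.get (p.map (genericPair n)).prod = 1 := by
  rw [prod_genericPair_eq_ιMulti, coordDet, ExteriorAlgebra.liftAlternating_apply_ιMulti,
    Pi.single_eq_same, AlternatingMap.compLinearMap_apply]
  refine Eq.trans ?_ (Matrix.det_one (n := Fin p.length))
  change Matrix.det _ = _
  congr 1
  ext i j
  simp [Matrix.one_apply, Finsupp.single_apply, hp.getElem_inj_iff, Fin.ext_iff]

theorem coordDet_eq_zero {k : ℕ} (K : Fin k → ℕ × ℕ) (p : List (ℕ × ℕ))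
    (h : p.length = k → ∃ q ∈ p, ∀ j, q ≠ K j) :
    coordDet K (p.map (genericPair n)).prod = 0 := by
  rw [prod_genericPair_eq_ιMulti, coordDet, ExteriorAlgebra.liftAlternating_apply_ιMulti]
  by_cases hk : p.length = k
  · subst hk
    obtain ⟨q, hq, hqK⟩ := h rfl
    obtain ⟨i, rfl⟩ := List.get_of_mem hq
    rw [Pi.single_eq_same, AlternatingMap.compLinearMap_apply]
    refine Matrix.det_eq_zero_of_row_eq_zero i fun j => ?_
    simpa using Finsupp.single_eq_of_ne' (hqK j)
  · rw [Pi.single_eq_of_ne hk]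
    rfl

theorem prod_genericPair_eq_baseChange_word (p : List (ℕ × ℕ)) :
    (p.map (genericPair n)).prod = baseChange n (word p) := by
  rw [word, map_list_prod, List.map_map]
  congr 1
  refine List.map_congr_left fun q _ => ?_
  exact (baseChange_pair q.1 q.2).symm

theorem varProd_eq_monomial (l : List (Fin n × ℕ × ℕ)) :
    varProd l = MvPolynomial.monomial
      (Multiset.toFinsupp
        ((l.map fun t => (t.1, t.2.1) : List (Fin n × ℕ)) : Multiset (Fin n × ℕ))) 1 := by
  induction l with
  | nil => simp [varProd]
  | cons t l ih =>
    simp only [varProd, List.map_cons, List.prod_cons] at ih ⊢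
    rw [ih, ← Multiset.cons_coe, ← Multiset.singleton_add, map_add, Multiset.toFinsupp_singleton,
      MvPolynomial.X, MvPolynomial.monomial_mul, one_mul]

/-- The functional takes an exterior coordinate, which fixes the pairs `(c, k)`, and then the
coefficient of a monomial, which fixes the pairs `(e, c)`. Distinct exterior factors make the
coordinate nonzero. -/
theorem exists_coefficient (l₀ : List (Fin n × ℕ × ℕ)) (hnd : (l₀.map Prod.snd).Nodup) :
    ∃ F : GenericAlgebra n →+ ℤ, F (cellProd l₀) = 1 ∧ ∀ l, F (cellProd l) ≠ 0 →
      (l.map fun t => (t.1, t.2.1)).Perm (l₀.map fun t => (t.1, t.2.1)) ∧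
      (l.map Prod.snd).Perm (l₀.map Prod.snd) := by
  set K := l₀.map Prod.snd with hK
  set m₀ := Multiset.toFinsupp
    ((l₀.map fun t => (t.1, t.2.1) : List (Fin n × ℕ)) : Multiset (Fin n × ℕ)) with hm₀
  let F : GenericAlgebra n →+ ℤ :=
    (MvPolynomial.lcoeff ℤ m₀).toAddMonoidHom.comp (coordDet K.get).toAddMonoidHom
  have hF : ∀ l, F (cellProd l) = MvPolynomial.coeff m₀
      (varProd l * coordDet K.get ((l.map Prod.snd).map (genericPair n)).prod) := by
    intro l
    change MvPolynomial.coeff m₀ (coordDet K.get (cellProd l)) = _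
    rw [cellProd_eq_smul, map_smul, smul_eq_mul, List.map_map]
    rfl
  refine ⟨F, ?_, fun l hl => ?_⟩
  · rw [hF, coordDet_self K hnd, mul_one, varProd_eq_monomial, MvPolynomial.coeff_monomial,
      if_pos rfl]
  · rw [hF] at hl
    have hperm : (l.map Prod.snd).Perm K := by
      by_contra hcon
      apply hl
      suffices h : coordDet K.get ((l.map Prod.snd).map (genericPair n)).prod = 0 by
        rw [h, mul_zero, MvPolynomial.coeff_zero]
      by_cases hnd' : (l.map Prod.snd).Nodup
      · refine coordDet_eq_zero _ _ fun hlen => ?_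
        by_contra! hsub
        refine hcon ((List.subperm_of_subset hnd' fun q hq => ?_).perm_of_length_le hlen.ge)
        obtain ⟨j, rfl⟩ := hsub q hq
        exact List.get_mem _ _
      · rw [prod_genericPair_eq_baseChange_word, word_of_not_nodup hnd', map_zero, map_zero]
    refine ⟨?_, hperm⟩
    have hcases : MvPolynomial.coeff m₀ (varProd l) ≠ 0 := by
      intro h0
      apply hl
      have h1 : coordDet K.get ((l.map Prod.snd).map (genericPair n)).prod = 1 ∨
          coordDet K.get ((l.map Prod.snd).map (genericPair n)).prod = -1 := by
        rw [← coordDet_self (n := n) K hnd, prod_genericPair_eq_baseChange_word,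
          prod_genericPair_eq_baseChange_word]
        rcases word_perm hperm with h | h
        · exact Or.inl (by rw [h])
        · exact Or.inr (by rw [h, map_neg, map_neg])
      rcases h1 with h | h <;> rw [h] <;> simp [h0]
    rw [varProd_eq_monomial, MvPolynomial.coeff_monomial] at hcases
    have heq : Multiset.toFinsupp
        ((l.map fun t => (t.1, t.2.1) : List (Fin n × ℕ)) : Multiset (Fin n × ℕ)) = m₀ := by
      by_contra hcon
      exact hcases (if_neg hcon)
    rw [hm₀, EmbeddingLike.apply_eq_iff_eq, Multiset.coe_eq_coe] at heq
    exact heq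

/-- Elements with distinct leading terms are linearly independent. -/
theorem eq_zero_of_hasLead {ι : Type*} {v : ι → GenericAlgebra n}
    {l : ι → List (Fin n × ℕ × ℕ)} (hlead : ∀ t, HasLead (v t) (l t))
    (hnd : ∀ t, ((l t).map Prod.snd).Nodup)
    (hinj : ∀ s t, ((l s).map fun t => (t.1, t.2.1)).Perm ((l t).map fun t => (t.1, t.2.1)) →
      ((l s).map Prod.snd).Perm ((l t).map Prod.snd) → s = t)
    (g : ι →₀ ℤ) (hg : g.sum (fun t a => (a : GenericAlgebra n) * v t) = 0) : g = 0 := by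
  classical
  by_contra hne
  obtain ⟨t₀, ht₀, hmin⟩ := g.support.exists_min_image (fun t => cellWeight (l t))
    (Finsupp.support_nonempty_iff.mpr hne)
  obtain ⟨F, hF1, hF⟩ := exists_coefficient (l t₀) (hnd t₀)
  -- `F` sees only cell products with the weight of `l t₀`, which is minimal on the support; all
  -- nonleading terms weigh more.
  have hhigh : ∀ t ∈ g.support, F (v t) = F (cellProd (l t)) := by
    intro t ht
    rw [← sub_eq_zero, ← map_sub]
    refine (?_ : higher n (cellWeight (l t)) ≤ F.ker) (hlead t)
    refine (AddSubgroup.closure_le _).mpr ?_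
    rintro _ ⟨l', hl', rfl⟩
    by_contra hcon
    obtain ⟨h1, h2⟩ := hF l' hcon
    rw [cellWeight_eq_of_perm h1 h2] at hl'
    exact lt_irrefl _ (hl'.trans_le (hmin t ht))
  have hzero : ∀ t ∈ g.support, t ≠ t₀ → F ((g t : GenericAlgebra n) * v t) = 0 := by
    intro t ht htne
    rw [← zsmul_eq_mul, map_zsmul, hhigh t ht]
    by_contra hcon
    obtain ⟨h1, h2⟩ := hF (l t) fun h0 => hcon (by rw [h0, smul_zero])
    exact htne (hinj _ _ h1 h2)
  have := congrArg F hg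
  rw [Finsupp.sum, map_sum, map_zero, Finset.sum_eq_single t₀ hzero fun h => (h ht₀).elim,
    ← zsmul_eq_mul, map_zsmul, hhigh t₀ ht₀, hF1, smul_eq_mul, mul_one] at this
  exact Finsupp.mem_support_iff.mp ht₀ this

end

end LetterPlaceAlgebra

/-! ### Leading terms of pairs of tableaux -/

namespace LetterPlaceAlgebra

noncomputable section

variable {n : ℕ} {μ : YoungDiagram}

/-- The triples `(T_{ij}, j, S_{ij})` of the `i`-th row of a pair of tableaux. -/
def cellRow (T : RowStrictTableau μ (Fin n)) (S : SemistandardYoungTableau μ) (i : ℕ) :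
    List (Fin n × ℕ × ℕ) :=
  List.ofFn fun j : Fin (μ.rowLen i) =>
    (T.entry ⟨(i, j), μ.mem_iff_lt_rowLen.mpr j.isLt⟩, (j : ℕ), S i j)

/-- The triples `(T_{ij}, j, S_{ij})` of a pair of tableaux, row by row. -/
def cellList (T : RowStrictTableau μ (Fin n)) (S : SemistandardYoungTableau μ) :
    List (Fin n × ℕ × ℕ) :=
  (List.ofFn fun i : Fin (μ.colLen 0) => cellRow T S i).flatten

theorem cellRow_eq_zip (T : RowStrictTableau μ (Fin n)) (S : SemistandardYoungTableau μ) (i : ℕ) :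
    cellRow T S i = (T.rowWord i).zip ((List.range (T.rowWord i).length).zip
      (List.ofFn fun j : Fin (μ.rowLen i) => S i j)) := by
  refine List.ext_getElem (by simp [cellRow, RowStrictTableau.rowWord]) fun j h1 h2 => ?_
  simp [cellRow, RowStrictTableau.rowWord]

theorem hasLead_prod_ofFn {k : ℕ} {x : Fin k → GenericAlgebra n}
    {l : Fin k → List (Fin n × ℕ × ℕ)} (h : ∀ i, HasLead (x i) (l i)) :
    HasLead (List.ofFn x).prod (List.ofFn l).flatten := by
  induction k with
  | zero => simpa using HasLead.one
  | succ k ih =>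
    rw [List.ofFn_succ, List.ofFn_succ, List.prod_cons, List.flatten_cons]
    exact (h 0).mul (ih fun i => h i.succ)

theorem pairwise_rowWord (T : RowStrictTableau μ (Fin n)) (i : ℕ) :
    (T.rowWord i).Pairwise (· < ·) := by
  rw [RowStrictTableau.rowWord, List.pairwise_ofFn]
  exact fun j j' hlt => T.row_strict i j j' _ _ hlt

theorem hasLead_tab (h : Fin n → ℕ) (T : RowStrictTableau μ (Fin n))
    (S : SemistandardYoungTableau μ)
    (hind : ∀ (i j : ℕ) (hj : j < (T.rowWord i).length), j < h (T.rowWord i)[j]) :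
    HasLead (genericRep h (tab T S)) (cellList T S) := by
  rw [tab, map_list_prod, List.map_ofFn]
  refine hasLead_prod_ofFn fun i => ?_
  rw [Function.comp_apply, cellRow_eq_zip, rowContent_eq_content]
  refine hasLead_bracket h (pairwise_rowWord T i) (hind i) ?_ (by simp [RowStrictTableau.rowWord])
  rw [List.pairwise_ofFn]
  exact fun j j' hlt => S.row_weak hlt (μ.mem_iff_lt_rowLen.mpr j'.isLt)

/-- Columns of `S` increase strictly, so no exterior factor `(j|p_k)` is repeated and the leading
term is nonzero. -/
theorem nodup_map_snd_cellList (T : RowStrictTableau μ (Fin n))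
    (S : SemistandardYoungTableau μ) : ((cellList T S).map Prod.snd).Nodup := by
  have hmem : ∀ (i : ℕ) (q : ℕ × ℕ), q ∈ (cellRow T S i).map Prod.snd →
      (i, q.1) ∈ μ ∧ q.2 = S i q.1 := by
    intro i q hq
    rw [cellRow, List.map_ofFn, List.mem_ofFn] at hq
    obtain ⟨j, rfl⟩ := hq
    exact ⟨μ.mem_iff_lt_rowLen.mpr j.isLt, rfl⟩
  rw [cellList, List.map_flatten, List.map_ofFn, List.nodup_flatten]
  constructor
  · intro l hl
    obtain ⟨i, rfl⟩ := List.mem_ofFn.mp hl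
    rw [Function.comp_apply, cellRow, List.map_ofFn, List.nodup_ofFn]
    intro j j' hjj
    simp only [Function.comp_apply, Prod.mk.injEq] at hjj
    exact Fin.ext hjj.1
  · rw [List.pairwise_ofFn]
    intro i i' hlt q hq hq'
    obtain ⟨-, h2⟩ := hmem i q hq
    obtain ⟨h3, h4⟩ := hmem i' q hq'
    have := S.col_strict (Fin.lt_def.mp hlt) h3
    omega

/-- A finite initial segment of the rows is recovered from its cardinality. -/
theorem lt_sum_iff_of_lower {P : ℕ → Prop} [DecidablePred P] (hP : ∀ i i', i ≤ i' → P i' → P i)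
    {B : ℕ} (hB : ∀ i, P i → i < B) (i : ℕ) :
    P i ↔ i < ∑ i : Fin B, if P i then 1 else 0 := by
  obtain ⟨K, hKB, hK⟩ : ∃ K, K ≤ B ∧ ∀ i, P i ↔ i < K := by
    have hex : ∃ K, ¬P K := ⟨B, fun h => lt_irrefl _ (hB B h)⟩
    refine ⟨Nat.find hex, Nat.find_min' hex fun h => lt_irrefl _ (hB B h), fun i => ?_⟩
    constructor
    · intro hi
      by_contra! hcon
      exact Nat.find_spec hex (hP _ _ hcon hi)
    · intro hi
      exact not_not.mp (Nat.find_min hex hi)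
  have hsum : (∑ i : Fin B, if P i then 1 else 0) = K := by
    rw [← Finset.sum_range (fun i => if P i then 1 else 0), ← Finset.card_filter]
    have : (Finset.range B).filter P = Finset.range K := by
      ext i
      rw [Finset.mem_filter, Finset.mem_range, Finset.mem_range, hK i]
      omega
    rw [this, Finset.card_range]
  rw [hsum, hK]

theorem sum_map_cellList (T : RowStrictTableau μ (Fin n)) (S : SemistandardYoungTableau μ)
    (f : Fin n × ℕ × ℕ → ℕ) (j : ℕ) (P : ℕ → Prop) [DecidablePred P]
    (hPμ : ∀ i, P i → (i, j) ∈ μ)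
    (hf : ∀ (i j' : ℕ) (h : (i, j') ∈ μ), f (T.entry ⟨(i, j'), h⟩, j', S i j') =
      if j' = j ∧ P i then 1 else 0) :
    ((cellList T S).map f).sum = ∑ i : Fin (μ.colLen 0), if P i then 1 else 0 := by
  rw [cellList, List.map_flatten, List.sum_flatten, List.map_ofFn, List.map_ofFn, List.sum_ofFn]
  refine Finset.sum_congr rfl fun i _ => ?_
  rw [Function.comp_apply, Function.comp_apply, cellRow, List.map_ofFn, List.sum_ofFn]
  have h1 : ∀ j' : Fin (μ.rowLen i), (f ∘ fun j' : Fin (μ.rowLen i) =>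
      (T.entry ⟨(i, j'), μ.mem_iff_lt_rowLen.mpr j'.isLt⟩, (j' : ℕ), S i j')) j' =
      if (j' : ℕ) = j ∧ P i then 1 else 0 := fun j' => hf i j' _
  rw [Finset.sum_congr rfl fun j' _ => h1 j']
  by_cases hP : P i
  · have hj : j < μ.rowLen i := μ.mem_iff_lt_rowLen.mp (hPμ i hP)
    rw [Finset.sum_eq_single ⟨j, hj⟩]
    · simp [hP]
    · intro b _ hb
      rw [if_neg]
      rintro ⟨h, -⟩
      exact hb (Fin.ext h)
    · simp
  · simp [hP]

theorem lt_sum_map_cellList_iff (T : RowStrictTableau μ (Fin n)) (S : SemistandardYoungTableau μ)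
    (f : Fin n × ℕ × ℕ → ℕ) (j : ℕ) (P : ℕ → Prop)
    (hP : ∀ i i', i ≤ i' → P i' → P i) (hPμ : ∀ i, P i → (i, j) ∈ μ)
    (hf : ∀ (i j' : ℕ) (h : (i, j') ∈ μ), j' ≠ j → f (T.entry ⟨(i, j'), h⟩, j', S i j') = 0)
    (hf1 : ∀ (i : ℕ) (h : (i, j) ∈ μ), P i → f (T.entry ⟨(i, j), h⟩, j, S i j) = 1)
    (hf0 : ∀ (i : ℕ) (h : (i, j) ∈ μ), ¬P i → f (T.entry ⟨(i, j), h⟩, j, S i j) = 0) (i : ℕ) :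
    P i ↔ i < ((cellList T S).map f).sum := by
  classical
  rw [sum_map_cellList T S f j P hPμ]
  · refine lt_sum_iff_of_lower hP (fun i hi => ?_) i
    exact μ.mem_iff_lt_colLen.mp (μ.up_left_mem le_rfl (Nat.zero_le j) (hPμ i hi))
  · intro i j' h
    by_cases hj : j' = j
    · subst hj
      by_cases hPi : P i
      · rw [hf1 i h hPi, if_pos ⟨rfl, hPi⟩]
      · rw [hf0 i h hPi, if_neg fun h => hPi h.2]
    · rw [hf i j' h hj, if_neg fun h => hj h.1]

/-- Entries at most `m` fill the top of a column, so their number locates them. The right side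
depends only on the multiset of pairs `(T i j, j)`. -/
theorem entry_le_iff (T : RowStrictTableau μ (Fin n)) (S : SemistandardYoungTableau μ)
    (i j : ℕ) (m : Fin n) : (∃ h : (i, j) ∈ μ, T.entry ⟨(i, j), h⟩ ≤ m) ↔
      i < (((cellList T S).map fun t => (t.1, t.2.1)).map fun p =>
        if p.2 = j ∧ p.1 ≤ m then 1 else 0).sum := by
  rw [List.map_map]
  refine lt_sum_map_cellList_iff T S _ j (fun i => ∃ h : (i, j) ∈ μ, T.entry ⟨(i, j), h⟩ ≤ m)
    ?_ ?_ ?_ ?_ ?_ i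
  · rintro i i' hii ⟨h, hm⟩
    rcases hii.eq_or_lt with rfl | hlt
    · exact ⟨h, hm⟩
    · exact ⟨μ.up_left_mem hii le_rfl h, (T.col_weak i i' j _ h hlt).trans hm⟩
  · rintro i ⟨h, -⟩
    exact h
  · intro i j' h hne
    simp [hne]
  · rintro i h ⟨_, hm⟩
    simp [hm]
  · intro i h hn
    simp only [Function.comp_apply, true_and]
    exact if_neg fun hm => hn ⟨h, hm⟩

theorem colEntry_le_iff (T : RowStrictTableau μ (Fin n)) (S : SemistandardYoungTableau μ)
    (i j m : ℕ) : ((i, j) ∈ μ ∧ S i j ≤ m) ↔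
      i < (((cellList T S).map Prod.snd).map fun p =>
        if p.1 = j ∧ p.2 ≤ m then 1 else 0).sum := by
  rw [List.map_map]
  refine lt_sum_map_cellList_iff T S _ j (fun i => (i, j) ∈ μ ∧ S i j ≤ m) ?_ ?_ ?_ ?_ ?_ i
  · rintro i i' hii ⟨h, hm⟩
    exact ⟨μ.up_left_mem hii le_rfl h, (S.col_weak hii h).trans hm⟩
  · rintro i ⟨h, -⟩
    exact h
  · intro i j' h hne
    simp [hne]
  · rintro i h ⟨_, hm⟩
    simp [hm]
  · intro i h hn
    simp only [Function.comp_apply, true_and]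
    exact if_neg fun hm => hn ⟨h, hm⟩

/-- A pair of tableaux is determined by its leading term. -/
theorem eq_of_cellList_perm {M : Matroid (Fin n)} {s t : IndepStandardTableau M}
    (h1 : ((cellList s.rowTab s.colTab).map fun t => (t.1, t.2.1)).Perm
      ((cellList t.rowTab t.colTab).map fun t => (t.1, t.2.1)))
    (h2 : ((cellList s.rowTab s.colTab).map Prod.snd).Perm
      ((cellList t.rowTab t.colTab).map Prod.snd)) : s = t := by
  obtain ⟨μ, T, S, hs⟩ := s
  obtain ⟨μ', T', S', ht⟩ := t
  simp only at h1 h2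
  have hT : ∀ i j m, (∃ h : (i, j) ∈ μ, T.entry ⟨(i, j), h⟩ ≤ m) ↔
      ∃ h : (i, j) ∈ μ', T'.entry ⟨(i, j), h⟩ ≤ m := by
    intro i j m
    rw [entry_le_iff T S, entry_le_iff T' S', (h1.map _).sum_eq]
  have hS : ∀ i j m, ((i, j) ∈ μ ∧ S i j ≤ m) ↔ ((i, j) ∈ μ' ∧ S' i j ≤ m) := by
    intro i j m
    rw [colEntry_le_iff T S, colEntry_le_iff T' S', (h2.map _).sum_eq]
  obtain rfl : μ = μ' := by
    ext ⟨i, j⟩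
    rw [YoungDiagram.mem_cells, YoungDiagram.mem_cells]
    exact ⟨fun h => ((hS i j _).mp ⟨h, le_rfl⟩).1, fun h => ((hS i j _).mpr ⟨h, le_rfl⟩).1⟩
  obtain rfl : T = T' := by
    have he : T.entry = T'.entry := by
      funext ⟨⟨i, j⟩, h⟩
      apply le_antisymm
      · exact ((hT i j _).mpr ⟨h, le_rfl⟩).2
      · exact ((hT i j _).mp ⟨h, le_rfl⟩).2
    cases T
    cases T'
    congr
  obtain rfl : S = S' := by
    ext i j
    by_cases h : (i, j) ∈ μ
    · exact le_antisymm ((hS i j _).mpr ⟨h, le_rfl⟩).2 ((hS i j _).mp ⟨h, le_rfl⟩).2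
    · rw [S.zeros h, S'.zeros h]
  rfl

end

end LetterPlaceAlgebra

/-! ### Independent sets of freedom matroids -/

/-- The rank of `{0, …, i}` in the freedom matroid `M_s`. -/
noncomputable def prefixRank {n : ℕ} (s : Fin (n + 1) → Bool) (i : Fin (n + 1)) : ℕ :=
  ({j | s j = true} ∩ Set.Iic i).ncard

theorem prefixRank_mono {n : ℕ} (s : Fin (n + 1) → Bool) : Monotone (prefixRank s) :=
  fun _ _ h => Set.ncard_le_ncard (Set.inter_subset_inter_right _ (Set.Iic_subset_Iic.mpr h))
    (Set.toFinite _)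

theorem ncard_inter_Iic_castSucc {n : ℕ} (I : Set (Fin (n + 2))) (i : Fin (n + 1)) :
    (I ∩ Set.Iic i.castSucc).ncard = (Fin.castSucc ⁻¹' I ∩ Set.Iic i).ncard := by
  rw [← Set.ncard_image_of_injective _ (Fin.castSucc_injective (n + 1))]
  congr 1
  ext x
  constructor
  · rintro ⟨hx, hxi⟩
    have hlt : x < Fin.last (n + 1) := lt_of_le_of_lt hxi (Fin.castSucc_lt_last i)
    refine ⟨x.castPred hlt.ne, ⟨by simpa using hx, ?_⟩, by simp⟩
    rw [Set.mem_Iic, ← Fin.castSucc_le_castSucc_iff]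
    simpa using hxi
  · rintro ⟨y, ⟨hy, hyi⟩, rfl⟩
    exact ⟨hy, Fin.castSucc_le_castSucc_iff.mpr hyi⟩

theorem inter_Iic_last {n : ℕ} (I : Set (Fin (n + 1))) : I ∩ Set.Iic (Fin.last n) = I :=
  Set.inter_eq_left.mpr fun x _ => Fin.le_last x

theorem ncard_eq_ncard_preimage_castSucc_add {n : ℕ} (I : Set (Fin (n + 2)))
    [Decidable (Fin.last (n + 1) ∈ I)] :
    I.ncard = (Fin.castSucc ⁻¹' I).ncard + if Fin.last (n + 1) ∈ I then 1 else 0 := by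
  have h1 : (I \ {Fin.last (n + 1)}).ncard = (Fin.castSucc ⁻¹' I).ncard := by
    rw [← Set.ncard_image_of_injective _ (Fin.castSucc_injective (n + 1))]
    congr 1
    ext x
    constructor
    · rintro ⟨hx, hne⟩
      have hne' : x ≠ Fin.last (n + 1) := hne
      exact ⟨x.castPred hne', by simpa using hx, by simp⟩
    · rintro ⟨y, hy, rfl⟩
      exact ⟨hy, by simp [Fin.castSucc_ne_last]⟩
  split_ifs with h
  · rw [← h1, Set.ncard_sdiff_singleton_add_one h (Set.toFinite _)]
  · rw [← h1, Set.sdiff_singleton_eq_self h, add_zero]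

theorem prefixRank_castSucc {n : ℕ} (s : Fin (n + 2) → Bool) (i : Fin (n + 1)) :
    prefixRank s i.castSucc = prefixRank (Fin.init s) i :=
  ncard_inter_Iic_castSucc _ i

theorem prefixRank_last {n : ℕ} (s : Fin (n + 2) → Bool) :
    prefixRank s (Fin.last (n + 1)) = prefixRank (Fin.init s) (Fin.last n) +
      if s (Fin.last (n + 1)) then 1 else 0 := by
  classical
  rw [prefixRank, prefixRank, inter_Iic_last, inter_Iic_last, ncard_eq_ncard_preimage_castSucc_add]
  rfl

/-- The set of positions of ones in `s` meets every bound with equality, so it is a largest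
independent set. -/
theorem Matroid.eRank_eq_prefixRank {n : ℕ} {M : Matroid (Fin (n + 1))} {s : Fin (n + 1) → Bool}
    (h : ∀ I, M.Indep I ↔ ∀ i, (I ∩ Set.Iic i).ncard ≤ prefixRank s i) :
    M.eRank = prefixRank s (Fin.last n) := by
  apply le_antisymm
  · obtain ⟨B, hB⟩ := M.exists_isBase
    rw [← hB.encard_eq_eRank, ← (Set.toFinite B).cast_ncard_eq]
    have := (h B).mp hB.indep (Fin.last n)
    rw [inter_Iic_last] at this
    exact_mod_cast this
  · have hI : M.Indep {j | s j = true} := (h _).mpr fun i => le_rfl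
    have := hI.encard_le_eRank
    rw [← (Set.toFinite _).cast_ncard_eq] at this
    rwa [prefixRank, inter_Iic_last]

theorem Matroid.addColoop_indep_iff {n : ℕ} (M : Matroid (Fin n)) (I : Set (Fin (n + 1))) :
    M.addColoop.Indep I ↔ M.Indep (Fin.castSucc ⁻¹' I) := by
  rw [Matroid.addColoop, Matroid.mapEquiv_indep_iff, Matroid.sum_indep_iff]
  have h : Sum.inl ⁻¹' (finSumFinEquiv.symm '' I) = Fin.castSucc ⁻¹' I := by
    ext x
    simp only [Set.mem_preimage, Equiv.image_symm_eq_preimage, finSumFinEquiv_apply_left]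
    rfl
  rw [h]
  simp

theorem Matroid.addColoop_ground {n : ℕ} (M : Matroid (Fin n)) (hM : M.E = Set.univ) :
    M.addColoop.E = Set.univ := by
  simp [Matroid.addColoop, hM]

theorem Matroid.truncateTo_indep_iff {α : Type*} [Finite α] (M : Matroid α) (k : ℕ) (I : Set α) :
    (M.truncateTo k).Indep I ↔ M.Indep I ∧ I.ncard ≤ k := by
  simp [Matroid.truncateTo]

theorem Matroid.addColoop_indep_iff_prefixRank {n : ℕ} {M : Matroid (Fin (n + 1))}
    {s : Fin (n + 2) → Bool} (hs : s (Fin.last (n + 1)) = true)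
    (h : ∀ I, M.Indep I ↔ ∀ i, (I ∩ Set.Iic i).ncard ≤ prefixRank (Fin.init s) i)
    (I : Set (Fin (n + 2))) :
    M.addColoop.Indep I ↔ ∀ i, (I ∩ Set.Iic i).ncard ≤ prefixRank s i := by
  classical
  rw [Matroid.addColoop_indep_iff, h]
  constructor
  · intro hI i
    induction i using Fin.lastCases with
    | last =>
      have := hI (Fin.last n)
      rw [inter_Iic_last] at this ⊢
      rw [prefixRank_last, hs, ncard_eq_ncard_preimage_castSucc_add, if_pos rfl]
      split_ifs <;> omega
    | cast i =>
      rw [ncard_inter_Iic_castSucc, prefixRank_castSucc]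
      exact hI i
  · intro hI i
    rw [← ncard_inter_Iic_castSucc, ← prefixRank_castSucc]
    exact hI _

/-- A coloop raises the last bound by one and so adds no constraint; a generic element keeps the
rank, which caps the total size of `I`. -/
theorem freedomMatroid_indep_iff (n : ℕ) (s : Fin (n + 1) → Bool) (I : Set (Fin (n + 1))) :
    (freedomMatroid n s).Indep I ↔ ∀ i, (I ∩ Set.Iic i).ncard ≤ prefixRank s i := by
  induction n with
  | zero =>
    have h1 : ∀ i : Fin 1, I ∩ Set.Iic i = I := fun i => by
      rw [Subsingleton.elim i (Fin.last 0), inter_Iic_last]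
    have h2 : ∀ i : Fin 1, prefixRank s i = ({j | s j = true} : Set (Fin 1)).ncard := fun i => by
      rw [Subsingleton.elim i (Fin.last 0), prefixRank, inter_Iic_last]
    simp only [h1, h2, freedomMatroid]
    by_cases hs : s 0 = true
    · have h3 : ({j | s j = true} : Set (Fin 1)) = Set.univ := by
        ext j
        rw [Subsingleton.elim j 0]
        simp [hs]
      rw [if_pos hs, h3, Matroid.freeOn_indep_iff]
      exact ⟨fun _ _ => Set.ncard_le_ncard (Set.subset_univ I) (Set.toFinite _),
        fun _ => Set.subset_univ I⟩
    · have h3 : ({j | s j = true} : Set (Fin 1)) = ∅ := by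
        ext j
        rw [Subsingleton.elim j 0]
        simp [hs]
      rw [if_neg hs, h3, Matroid.loopyOn_indep_iff, Set.ncard_empty]
      constructor
      · rintro rfl
        simp
      · intro h
        exact (Set.ncard_eq_zero (Set.toFinite I)).mp (Nat.le_zero.mp (h 0))
  | succ n ih =>
    rw [freedomMatroid]
    split_ifs with hs
    · exact Matroid.addColoop_indep_iff_prefixRank hs (ih (Fin.init s)) I
    -- The generic extension truncates the coloop extension, whose sequence is `s'`; its rank is one
    -- more than the cap sought.
    · set s' : Fin (n + 2) → Bool := Fin.snoc (Fin.init s) true with hs'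
      have hlast : s' (Fin.last (n + 1)) = true := by simp [hs']
      have hinit : Fin.init s' = Fin.init s := by simp [hs']
      have key := Matroid.addColoop_indep_iff_prefixRank (M := freedomMatroid n (Fin.init s))
        hlast (by rw [hinit]; exact ih (Fin.init s))
      have hrank := Matroid.eRank_eq_prefixRank key
      rw [Matroid.addGeneric, Matroid.truncation, Matroid.truncateTo_indep_iff, hrank,
        prefixRank_last, hlast, hinit, if_pos rfl, ENat.toNat_natCast, Nat.add_sub_cancel,
        Matroid.addColoop_indep_iff, ih]
      constructor
      · rintro ⟨h1, h2⟩ i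
        induction i using Fin.lastCases with
        | last =>
          rw [inter_Iic_last, prefixRank_last, if_neg hs, add_zero]
          exact h2
        | cast i =>
          rw [ncard_inter_Iic_castSucc, prefixRank_castSucc]
          exact h1 i
      · intro hI
        constructor
        · intro i
          rw [← ncard_inter_Iic_castSucc, ← prefixRank_castSucc]
          exact hI _
        · have := hI (Fin.last (n + 1))
          rwa [inter_Iic_last, prefixRank_last, if_neg hs, add_zero] at this

theorem freedomMatroid_ground (n : ℕ) (s : Fin (n + 1) → Bool) :
    (freedomMatroid n s).E = Set.univ := by
  induction n with
  | zero =>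
    rw [freedomMatroid]
    split_ifs <;> simp
  | succ n ih =>
    rw [freedomMatroid]
    split_ifs
    · exact Matroid.addColoop_ground _ (ih _)
    · rw [Matroid.addGeneric, Matroid.truncation]
      exact Matroid.addColoop_ground _ (ih _)

/-! ### The basis of the Whitney module -/

open LetterPlaceAlgebra

theorem WhitneyModule.mk_eq_zero_iff {E : Type*} (M : Matroid E) (x : LetterPlaceAlgebra E) :
    WhitneyModule.mk M x = 0 ↔ x ∈ whitneyIdeal M := by
  have h := TwoSidedIdeal.ker_ringCon_mk' (whitneyIdeal M)
  conv_rhs => rw [← h]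
  exact (TwoSidedIdeal.mem_ker _).symm

theorem WhitneyModule.mk_surjective {E : Type*} (M : Matroid E) :
    Function.Surjective (WhitneyModule.mk M) := RingCon.mk'_surjective _

theorem WhitneyModule.mk_tab_eq_zero {n : ℕ} {M : Matroid (Fin n)} {μ : YoungDiagram}
    (T : RowStrictTableau μ (Fin n)) (S : SemistandardYoungTableau μ) (i : ℕ)
    (hi : M.Dep {e | e ∈ T.rowWord i}) : WhitneyModule.mk M (tab T S) = 0 := by
  have hi' : i < μ.colLen 0 := by
    by_contra hcon
    obtain ⟨e, he⟩ := hi.nonempty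
    rw [Set.mem_ofPred_eq, RowStrictTableau.rowWord, List.mem_ofFn] at he
    obtain ⟨j, -⟩ := he
    exact hcon (μ.mem_iff_lt_colLen.mp (μ.up_left_mem le_rfl (Nat.zero_le j)
      (μ.mem_iff_lt_rowLen.mpr j.isLt)))
  rw [tab, map_list_prod, List.map_ofFn]
  refine List.prod_eq_zero (List.mem_ofFn.mpr ⟨⟨i, hi'⟩, ?_⟩)
  rw [Function.comp_apply, WhitneyModule.mk_eq_zero_iff]
  refine TwoSidedIdeal.subset_span ⟨_, _, hi, ?_, rfl⟩
  rw [rowContent_eq_content, degree_content]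
  simp [RowStrictTableau.rowWord]

/-- The standard tableaux with independent rows span the Whitney module. -/
theorem WhitneyModule.span_tab_eq_top {n : ℕ} (M : Matroid (Fin n)) (hM : M.E = Set.univ) :
    Submodule.span ℤ (Set.range fun t : IndepStandardTableau M =>
      WhitneyModule.mk M (tab t.rowTab t.colTab)) = ⊤ := by
  set W := Submodule.span ℤ (Set.range fun t : IndepStandardTableau M =>
      WhitneyModule.mk M (tab t.rowTab t.colTab)) with hW
  -- The preimage of `W` under the quotient map, to which straightening applies.
  let V : Submodule ℤ (LetterPlaceAlgebra (Fin n)) :=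
    { carrier := {x | WhitneyModule.mk M x ∈ W}
      add_mem' := fun {a b} ha hb => by
        rw [Set.mem_ofPred_eq, map_add]
        exact W.add_mem ha hb
      zero_mem' := by
        rw [Set.mem_ofPred_eq, map_zero]
        exact W.zero_mem
      smul_mem' := fun r x hx => by
        rw [Set.mem_ofPred_eq, Algebra.smul_def, map_mul, eq_intCast, map_intCast, ← zsmul_eq_mul]
        exact W.smul_mem r hx }
  have hV : V = ⊤ := by
    refine eq_top_of_rowsProd_mem V (rowsProd_mem V fun L hrow hchain => ?_)
    obtain ⟨μ, T, S, h⟩ := exists_tab_eq_rowsProd hrow hchain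
    rw [← h]
    change WhitneyModule.mk M (tab T S) ∈ W
    by_cases hind : ∀ i, M.Indep {e | e ∈ T.rowWord i}
    · exact Submodule.subset_span ⟨⟨μ, T, S, hind⟩, rfl⟩
    · push Not at hind
      obtain ⟨i, hi⟩ := hind
      rw [WhitneyModule.mk_tab_eq_zero T S i ((M.not_indep_iff (by simp [hM])).mp hi)]
      exact W.zero_mem
  rw [eq_top_iff]
  intro z _
  obtain ⟨x, rfl⟩ := WhitneyModule.mk_surjective M z
  have hx : x ∈ V := by rw [hV]; trivial
  exact hx

/-- A dependent word violates some prefix bound, and counting its letters with multiplicity only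
strengthens the violation. -/
theorem whitneyIdeal_freedomMatroid_le_ker (n : ℕ) (s : Fin (n + 1) → Bool) :
    whitneyIdeal (freedomMatroid n s) ≤ TwoSidedIdeal.ker (genericRep (prefixRank s)) := by
  rw [whitneyIdeal, TwoSidedIdeal.span_le]
  rintro _ ⟨w, α, hdep, -, rfl⟩
  rw [SetLike.mem_coe, TwoSidedIdeal.mem_ker]
  have hnot := hdep.not_indep
  rw [freedomMatroid_indep_iff] at hnot
  push Not at hnot
  obtain ⟨i, hi⟩ := hnot
  refine genericRep_bracket_eq_zero (prefixRank_mono s) i (hi.trans_le ?_) α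
  have h1 : ({e | e ∈ w} ∩ Set.Iic i : Set _) = ((w.filter (· ≤ i)).toFinset : Set _) := by
    ext e
    simp
  rw [h1, Set.ncard_coe_finset]
  exact List.toFinset_card_le _

/-- The first `j + 1` letters are distinct and at most `w[j]`, so the prefix bound there is at least
`j + 1`. Hence the diagonal leading term of the row is present. -/
theorem lt_prefixRank_getElem {n : ℕ} {s : Fin (n + 1) → Bool} {w : List (Fin (n + 1))}
    (hw : w.Pairwise (· < ·)) (hind : (freedomMatroid n s).Indep {e | e ∈ w}) (j : ℕ)
    (hj : j < w.length) : j < prefixRank s w[j] := by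
  rw [freedomMatroid_indep_iff] at hind
  refine lt_of_lt_of_le ?_ (hind w[j])
  have h2 : ((w.take (j + 1)).toFinset : Set _) ⊆ {e | e ∈ w} ∩ Set.Iic w[j] := by
    intro e he
    rw [Finset.mem_coe, List.mem_toFinset, List.mem_take_iff_getElem] at he
    obtain ⟨k, hk, rfl⟩ := he
    refine ⟨List.getElem_mem _, ?_⟩
    rw [Set.mem_Iic]
    rcases (show k ≤ j by omega).eq_or_lt with rfl | hlt
    · exact le_rfl
    · exact (List.pairwise_iff_getElem.mp hw k j _ _ hlt).le
  have h3 := Set.ncard_le_ncard h2 (Set.toFinite _)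
  rw [Set.ncard_coe_finset, List.toFinset_card_of_nodup (hw.nodup.sublist (List.take_sublist _ _)),
    List.length_take] at h3
  omega

/-- The standard tableaux with independent rows are linearly independent in the Whitney module of a
freedom matroid. -/
theorem WhitneyModule.linearIndependent_tab (n : ℕ) (s : Fin (n + 1) → Bool) :
    LinearIndependent ℤ fun t : IndepStandardTableau (freedomMatroid n s) =>
      WhitneyModule.mk (freedomMatroid n s) (tab t.rowTab t.colTab) := by
  rw [linearIndependent_iff]
  intro g hg
  have h1 : WhitneyModule.mk (freedomMatroid n s)
      (g.sum fun t a => (a : LetterPlaceAlgebra (Fin (n + 1))) * tab t.rowTab t.colTab) = 0 := by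
    rw [← hg, Finsupp.linearCombination_apply, Finsupp.sum, Finsupp.sum, map_sum]
    refine Finset.sum_congr rfl fun t _ => ?_
    rw [map_mul, map_intCast, ← zsmul_eq_mul]
  have h2 := whitneyIdeal_freedomMatroid_le_ker n s ((WhitneyModule.mk_eq_zero_iff _ _).mp h1)
  rw [TwoSidedIdeal.mem_ker, Finsupp.sum, map_sum] at h2
  have h3 : ∀ t : IndepStandardTableau (freedomMatroid n s), HasLead
      (genericRep (prefixRank s) (tab t.rowTab t.colTab)) (cellList t.rowTab t.colTab) := fun t =>
    hasLead_tab _ _ _ fun i j hj =>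
      lt_prefixRank_getElem (pairwise_rowWord t.rowTab i) (t.indep i) j hj
  refine eq_zero_of_hasLead h3 (fun t => nodup_map_snd_cellList _ _)
    (fun _ _ => eq_of_cellList_perm) g ?_
  rw [Finsupp.sum]
  refine Eq.trans (Finset.sum_congr rfl fun t _ => ?_) h2
  rw [map_mul, map_intCast]

theorem mainTheorem1 (n : ℕ) (M : Matroid (Fin (n + 1))) (hM : IsFreedomMatroid M) :
    Module.Free ℤ (WhitneyModule M) ∧
      ∃ b : Module.Basis (IndepStandardTableau M) ℤ (WhitneyModule M),
        ∀ t : IndepStandardTableau M, b t = WhitneyModule.mk M (tab t.rowTab t.colTab) := by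
  obtain ⟨s, rfl⟩ := hM
  let b := Module.Basis.mk (WhitneyModule.linearIndependent_tab n s)
    (WhitneyModule.span_tab_eq_top _ (freedomMatroid_ground n s)).ge
  exact ⟨Module.Free.of_basis b, b, fun t => Module.Basis.mk_apply _ _ t⟩
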